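/- Let $\mathcal F$ be a finite set of propositional connectives, each with an arity (possibly $0$) and a truth function, that is functionally complete: every Boolean function of at least one variable is given by a term over $\mathcal F$. Formulae are built in De Bruijn notation: $(\underline{n}\in\underline{m})$ is a formula for all indices $n,m\in\mathbb N$; if $\varphi$ is a formula, so are $\forall\varphi$ and $\exists\varphi$; and if $\circ\in\mathcal F$ has arity $k$ and $\varphi_1,\dots,\varphi_k$ are formulae, then $\circ(\varphi_1,\dots,\varphi_k)$ is a formula. The index $\underline{n}$ is the $n$-fold successor of zero, $S^{(n)}0$, and the size of a formula is its number of constructors, each occurrence of $S$, $0$, $\in$, $\forall$, $\exists$ and of a connective having weight one. Let $a_n$ be the (finite) number of formulae of size $n$, free indices being allowed, and let $\Phi_\infty(z)=\sum_{n\ge 0}a_nz^n$. Then there are real numbers $\rho,a,b,C$ with $0<\rho<1$ and $a,b,C>0$ such that the following hold. 1. $\rho$ is the unique dominant singularity of $\Phi_\infty$: the radius of convergence of the series is $\rho$, and among the points $w$ with $|w|=\rho$ the point $w=\rho$ is the only one to a neighbourhood of which $\Phi_\infty$ cannot be continued analytically. 2. For some $R>\rho$, $\Phi_\infty$ continues analytically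 to the slit disk $\{z:|z|<R\}\setminus[\rho,\infty)$. As $z\to\rho$ in the slit disk it has a convergent Puiseux expansion $\Phi_\infty(z)=\sum_{k\ge 0}c_k\left(\sqrt{1-z/\rho}\right)^k$ (principal square root) with $c_0=a$ and $c_1=-b$, and in particular $$\Phi_\infty(z)=a-b\sqrt{1-\frac z\rho}+O\left(\left|1-\frac z\rho\right|\right).$$ 3. $a_n\sim C\,\rho^{-n}\,n^{-3/2}$ as $n\to\infty$. -/

import Mathlib

open Filter Topology Asymptotics

namespace DeBruijnFormula

/-- Formulae over one binary membership predicate, in De Bruijn notation. The propositional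
connectives are the elements of `ι`, and `ar i` is the arity of the connective `i`.
A De Bruijn index is a natural number (`0` or a successor). -/
inductive Formula {ι : Type*} (ar : ι → ℕ) : Type _
  | mem (n m : ℕ) : Formula ar
  | all (φ : Formula ar) : Formula ar
  | ex (φ : Formula ar) : Formula ar
  | conn (i : ι) (args : Fin (ar i) → Formula ar) : Formula ar

/-- The size of the index `n = S (S (… 0))`: one for each successor and one for zero. -/
def indexSize (n : ℕ) : ℕ := n + 1

/-- The natural size: every constructor (successor, zero, membership, quantifier, connective)
has weight one. -/
def Formula.size {ι : Type*} {ar : ι → ℕ} : Formula ar → ℕ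
  | .mem n m => 1 + indexSize n + indexSize m
  | .all φ => 1 + φ.size
  | .ex φ => 1 + φ.size
  | .conn _ args => 1 + ∑ j, (args j).size

/-- The number of formulae of size `n` (a finite number, see `finite_size_eq`). -/
noncomputable def count {ι : Type*} (ar : ι → ℕ) (n : ℕ) : ℕ :=
  {φ : Formula ar | φ.size = n}.ncard

theorem finite_size_le {ι : Type*} [Finite ι] (ar : ι → ℕ) (n : ℕ) :
    {φ : Formula ar | φ.size ≤ n}.Finite := by
  induction n with
  | zero =>
    refine Set.Finite.subset Set.finite_empty fun φ hφ => ?_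
    cases φ <;> simp [Formula.size] at hφ
  | succ n ih =>
    set S : Set (Formula ar) := {φ | φ.size ≤ n} with hS
    have h1 : ((fun p : ℕ × ℕ => (Formula.mem p.1 p.2 : Formula ar)) ''
        (Set.Iic n ×ˢ Set.Iic n)).Finite :=
      ((Set.finite_Iic n).prod (Set.finite_Iic n)).image _
    have h4 : (⋃ i, (fun args => (Formula.conn i args : Formula ar)) ''
        (Set.pi Set.univ fun _ : Fin (ar i) => S)).Finite :=
      Set.finite_iUnion fun i => (Set.Finite.pi fun _ => ih).image _
    refine (h1.union ((ih.image Formula.all).union ((ih.image Formula.ex).union h4))).subset ?_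
    rintro (⟨k, m⟩ | φ | φ | ⟨i, args⟩) hφ
    · simp only [Formula.size, indexSize, Set.mem_ofPred_eq] at hφ
      exact Or.inl ⟨(k, m), ⟨by simp; omega, by simp; omega⟩, rfl⟩
    · simp only [Formula.size, Set.mem_ofPred_eq] at hφ
      exact Or.inr (Or.inl ⟨φ, by simp [hS]; omega, rfl⟩)
    · simp only [Formula.size, Set.mem_ofPred_eq] at hφ
      exact Or.inr (Or.inr (Or.inl ⟨φ, by simp [hS]; omega, rfl⟩))
    · simp only [Formula.size, Set.mem_ofPred_eq] at hφ
      refine Or.inr (Or.inr (Or.inr (Set.mem_iUnion.2 ⟨i, args, fun j _ => ?_, rfl⟩)))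
      have := Finset.single_le_sum (f := fun j => (args j).size) (fun _ _ => Nat.zero_le _)
        (Finset.mem_univ j)
      simp only [hS, Set.mem_ofPred_eq] at this ⊢
      omega

theorem finite_size_eq {ι : Type*} [Finite ι] (ar : ι → ℕ) (n : ℕ) :
    {φ : Formula ar | φ.size = n}.Finite :=
  (finite_size_le ar n).subset fun _ h => le_of_eq h

/-- The Boolean functions of `n` variables that are given by a propositional term built from the
variables and the connectives, where `tt i` is the truth function of the connective `i`. -/
inductive Expressible {ι : Type*} {ar : ι → ℕ} (tt : ∀ i, (Fin (ar i) → Bool) → Bool) (n : ℕ) :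
    ((Fin n → Bool) → Bool) → Prop
  | var (k : Fin n) : Expressible tt n fun v => v k
  | comp (i : ι) (g : Fin (ar i) → (Fin n → Bool) → Bool) (hg : ∀ j, Expressible tt n (g j)) :
      Expressible tt n fun v => tt i fun j => g j v

/-- Functional completeness: every Boolean function of at least one variable is expressible. -/
def FunctionallyComplete {ι : Type*} {ar : ι → ℕ} (tt : ∀ i, (Fin (ar i) → Bool) → Bool) : Prop :=
  ∀ n : ℕ, 1 ≤ n → ∀ f : (Fin n → Bool) → Bool, Expressible tt n f

/-- The sum of the power series with coefficients `c`. -/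
noncomputable def powerSum (c : ℕ → ℂ) (z : ℂ) : ℂ := ∑' n, c n * z ^ n

/-- The point `w` is a singularity of the power series with coefficients `c`, whose disk of
convergence has `w` on its boundary: the sum in the disk has no analytic continuation to a
neighbourhood of `w`. -/
def IsSingularPoint (c : ℕ → ℂ) (w : ℂ) : Prop :=
  ¬ ∃ g : ℂ → ℂ, AnalyticAt ℂ g w ∧
    ∀ᶠ z in 𝓝[Metric.ball 0 ‖w‖] w, g z = powerSum c z

/-- The point `ζ` is the unique dominant singularity of the power series with coefficients `c`:
the radius of convergence is `|ζ|`, and `ζ` is the one and only singularity of modulus `|ζ|`. -/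
def IsUniqueDominantSingularity (c : ℕ → ℂ) (ζ : ℂ) : Prop :=
  (FormalMultilinearSeries.ofScalars ℂ c).radius = ENNReal.ofReal ‖ζ‖ ∧
    ∀ w : ℂ, ‖w‖ = ‖ζ‖ → (IsSingularPoint c w ↔ w = ζ)

/-- The open disk of radius `R` about `0` without the real half-line `[ρ, ∞)`. -/
def slitDisk (ρ R : ℝ) : Set ℂ := {z | ‖z‖ < R ∧ ¬ (ρ ≤ z.re ∧ z.im = 0)}

/-- The coefficients of the generating function of all formulae. -/
noncomputable def genCoeff {ι : Type*} (ar : ι → ℕ) (n : ℕ) : ℂ := (count ar n : ℂ)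

end DeBruijnFormula

/-! Sorting formulae by their outermost constructor shows that the generating function solves `y =
atomGen z + z * P y`, where `P = 2 X + ∑ i, X ^ ar i`. The coefficients of `P` are nonnegative.
Connectives of arity at most one only give functions of a single variable, so functional
completeness forces an arity of at least two, and `P` is nonlinear. This is all that is used of
completeness, and it is the source of the square root.

The singularity is where `y` stops being an analytic function of `z` by the implicit function
theorem: a positive solution `(ρ, τ)` of the equation together with `ρ * P' τ = 1`
(`IsBranching.exists_isCharacteristic`). If `‖z‖ ≤ ρ` and `z ≠ ρ`, the strict inequality `‖atomGen
z‖ < atomGen ρ` makes the right-hand side a contraction of a disk of radius below `τ`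
(`mem_contrDomain`). Its fixed point `genFix` is therefore analytic at every point of the closed
disk except `ρ`. At `ρ`, the substitution `z = ρ (1 - s ^ 2)`, `y = τ - s u` turns the degenerate
equation into one with a simple root `u = b > 0` at `s = 0` (`exists_branch`). So near `ρ` the
solution is `ψ (√(1 - z / ρ))` with `ψ` analytic, `ψ 0 = τ` and `ψ' 0 = -b`. The two descriptions
agree inside the disk and glue to a function on a slit disk (`exists_slitDisk_continuation`).

The sum over formulae converges on the closed disk with value at most `τ` in norm, and uniqueness of
the fixed point identifies it with `genFix` inside the disk (`hasSum_genCoeff_genFix`). Since `ψ' 0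
≠ 0`, the point `ρ` is a singularity. The coefficient asymptotics follow by Darboux's method
(`tendsto_coeff_of_sqrt_singularity`): without its odd terms in `s` of degree one and three the
function has a bounded second derivative, so the remaining coefficients are `O(n ^ (-2))`, and the
term `-b s` contributes `-b / Γ(-1/2) * n ^ (-3/2)`. -/

namespace DeBruijnFormula

/-! ### Estimates for polynomials with nonnegative coefficients. -/

section NonnegPolynomial

variable {Q : Polynomial ℝ} {x y : ℝ}

theorem eval_nonneg_of_coeff_nonneg (hQ : ∀ k, 0 ≤ Q.coeff k) (hx : 0 ≤ x) : 0 ≤ Q.eval x := by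
  rw [Polynomial.eval_eq_sum_range]
  exact Finset.sum_nonneg fun i _ => mul_nonneg (hQ i) (pow_nonneg hx i)

theorem eval_le_eval_of_coeff_nonneg (hQ : ∀ k, 0 ≤ Q.coeff k) (hx : 0 ≤ x) (hxy : x ≤ y) :
    Q.eval x ≤ Q.eval y := by
  rw [Polynomial.eval_eq_sum_range, Polynomial.eval_eq_sum_range]
  exact Finset.sum_le_sum fun i _ => mul_le_mul_of_nonneg_left (pow_le_pow_left₀ hx hxy i) (hQ i)

theorem coeff_mul_pow_le_eval (hQ : ∀ k, 0 ≤ Q.coeff k) (hx : 0 ≤ x) (j : ℕ) :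
    Q.coeff j * x ^ j ≤ Q.eval x := by
  rw [Polynomial.eval_eq_sum_range]
  by_cases hj : j ∈ Finset.range (Q.natDegree + 1)
  · exact Finset.single_le_sum (f := fun i => Q.coeff i * x ^ i)
      (fun i _ => mul_nonneg (hQ i) (pow_nonneg hx i)) hj
  · rw [Polynomial.coeff_eq_zero_of_natDegree_lt (by simpa using hj), zero_mul]
    exact Finset.sum_nonneg fun i _ => mul_nonneg (hQ i) (pow_nonneg hx i)

theorem eval_lt_eval_of_coeff_nonneg (hQ : ∀ k, 0 ≤ Q.coeff k) {j : ℕ} (hj : j ≠ 0)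
    (hQj : 0 < Q.coeff j) (hx : 0 ≤ x) (hxy : x < y) : Q.eval x < Q.eval y := by
  rw [Polynomial.eval_eq_sum_range, Polynomial.eval_eq_sum_range]
  refine Finset.sum_lt_sum (fun i _ =>
    mul_le_mul_of_nonneg_left (pow_le_pow_left₀ hx hxy.le i) (hQ i)) ⟨j, ?_, ?_⟩
  · simpa [Nat.lt_succ_iff] using Polynomial.le_natDegree_of_ne_zero hQj.ne'
  · exact mul_lt_mul_of_pos_left (pow_lt_pow_left₀ hxy hx hj) hQj

theorem coeff_derivative_nonneg (hQ : ∀ k, 0 ≤ Q.coeff k) (k : ℕ) :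
    0 ≤ (Polynomial.derivative Q).coeff k := by
  rw [Polynomial.coeff_derivative]
  exact mul_nonneg (hQ _) (by positivity)

theorem norm_aeval_le_eval_norm (hQ : ∀ k, 0 ≤ Q.coeff k) (z : ℂ) :
    ‖Polynomial.aeval z Q‖ ≤ Q.eval ‖z‖ := by
  rw [Polynomial.aeval_eq_sum_range, Polynomial.eval_eq_sum_range]
  refine (norm_sum_le _ _).trans (Finset.sum_le_sum fun i _ => ?_)
  rw [norm_smul, norm_pow, Real.norm_of_nonneg (hQ i)]

theorem norm_aeval_sub_aeval_le (hQ : ∀ k, 0 ≤ Q.coeff k) {z w : ℂ} (hz : ‖z‖ ≤ x)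
    (hw : ‖w‖ ≤ x) :
    ‖Polynomial.aeval z Q - Polynomial.aeval w Q‖ ≤
      (Polynomial.derivative Q).eval x * ‖z - w‖ := by
  refine (convex_closedBall (0 : ℂ) x).norm_image_sub_le_of_norm_hasDerivWithin_le
    (f := fun z => Polynomial.aeval z Q)
    (f' := fun z => Polynomial.aeval z (Polynomial.derivative Q))
    (fun u _ => (Polynomial.hasDerivAt_aeval Q u).hasDerivWithinAt) (fun u hu => ?_)
    (by simpa using hw) (by simpa using hz)
  exact (norm_aeval_le_eval_norm (coeff_derivative_nonneg hQ) u).trans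
    (eval_le_eval_of_coeff_nonneg (coeff_derivative_nonneg hQ) (norm_nonneg u) (by simpa using hu))

/-- `T 0` is half the second derivative of `Q` at `x`; it is positive because of the term of degree
`j ≥ 2`. It is the coefficient that makes the branch point quadratic. -/
theorem exists_second_order_taylor (hQ : ∀ k, 0 ≤ Q.coeff k) {j : ℕ} (hj : 2 ≤ j)
    (hQj : 0 < Q.coeff j) (hx : 0 < x) :
    ∃ T : Polynomial ℝ, 0 < T.eval 0 ∧ ∀ w : ℂ, Polynomial.aeval ((x : ℂ) + w) Q =
      ((Q.eval x : ℝ) : ℂ) + w * (((Polynomial.derivative Q).eval x : ℝ) : ℂ) +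
        w ^ 2 * Polynomial.aeval w T := by
  refine ⟨(Polynomial.taylor x Q).divX.divX, ?_, fun w => ?_⟩
  · rw [← Polynomial.coeff_zero_eq_eval_zero, Polynomial.coeff_divX, Polynomial.coeff_divX,
      Polynomial.taylor_coeff]
    have hc : ∀ k, 0 ≤ (Polynomial.hasseDeriv 2 Q).coeff k := fun k => by
      rw [Polynomial.hasseDeriv_coeff]
      exact mul_nonneg (Nat.cast_nonneg _) (hQ _)
    refine lt_of_lt_of_le ?_ (coeff_mul_pow_le_eval hc hx.le (j - 2))
    rw [Polynomial.hasseDeriv_coeff, Nat.sub_add_cancel hj]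
    have : 0 < j.choose 2 := Nat.choose_pos hj
    positivity
  · have h1 := Polynomial.divX_mul_X_add (Polynomial.taylor x Q)
    have h2 := Polynomial.divX_mul_X_add (Polynomial.taylor x Q).divX
    rw [← h2, Polynomial.coeff_divX, Polynomial.taylor_coeff_one, Polynomial.taylor_coeff_zero] at h1
    have h3 := congrArg (Polynomial.aeval w) h1
    simp only [map_add, map_mul, Polynomial.aeval_X, Polynomial.aeval_C, Polynomial.taylor_apply,
      Polynomial.aeval_comp, Complex.coe_algebraMap] at h3
    rw [add_comm (x : ℂ) w, ← h3, Polynomial.taylor_apply]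
    ring

end NonnegPolynomial

/-! ### The characteristic system. -/

/-- `P` has the properties of the polynomial `2 X + ∑ i, X ^ ar i` of a functionally complete set of
connectives that the analysis of the generating function depends on. -/
structure IsBranching (P : Polynomial ℝ) : Prop where
  coeff_nonneg : ∀ k, 0 ≤ P.coeff k
  two_le_coeff_one : 2 ≤ P.coeff 1
  exists_one_le_coeff : ∃ k, 2 ≤ k ∧ 1 ≤ P.coeff k

/-- The generating function `z ^ 3 / (1 - z) ^ 2` of the atomic formulae. -/
noncomputable def atomGen {K : Type*} [Field K] (z : K) : K := z ^ 3 / (1 - z) ^ 2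

/-- `(ρ, τ)` is a solution of the characteristic system of `y = atomGen z + z * P y`. -/
structure IsCharacteristic (P : Polynomial ℝ) (ρ τ : ℝ) : Prop where
  pos : 0 < ρ
  lt_one : ρ < 1
  pos' : 0 < τ
  eq : atomGen ρ + ρ * P.eval τ = τ
  deriv_eq : ρ * (Polynomial.derivative P).eval τ = 1

theorem IsBranching.two_le_eval_derivative {P : Polynomial ℝ} (hP : IsBranching P) {x : ℝ}
    (hx : 0 ≤ x) : 2 ≤ (Polynomial.derivative P).eval x := by
  have h := coeff_mul_pow_le_eval (coeff_derivative_nonneg hP.coeff_nonneg) hx 0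
  have := hP.two_le_coeff_one
  rw [Polynomial.coeff_derivative] at h
  norm_num at h
  linarith

/-- The polynomial `X P' - P + P 0` has the nonnegative coefficients `(n - 1) P_n` for `n ≥ 1`, and
its term of degree `k ≥ 2` alone is at least `x ^ 2`. -/
theorem IsBranching.sq_sub_le {P : Polynomial ℝ} (hP : IsBranching P) {x : ℝ} (hx : 1 ≤ x) :
    x ^ 2 - P.coeff 0 ≤ x * (Polynomial.derivative P).eval x - P.eval x := by
  obtain ⟨k, hk, hPk⟩ := hP.exists_one_le_coeff
  have hR : ∀ n, (Polynomial.X * Polynomial.derivative P - P + Polynomial.C (P.coeff 0)).coeff n =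
      if n = 0 then 0 else (n - 1) * P.coeff n := by
    intro n
    rcases n with _ | n
    · simp
    · simp [Polynomial.coeff_X_mul, Polynomial.coeff_derivative]
      ring
  have hnn : ∀ n, 0 ≤ (Polynomial.X * Polynomial.derivative P - P +
      Polynomial.C (P.coeff 0)).coeff n := by
    intro n
    rw [hR]
    split_ifs with h
    · exact le_rfl
    · refine mul_nonneg ?_ (hP.coeff_nonneg n)
      have : (1 : ℝ) ≤ n := by exact_mod_cast Nat.one_le_iff_ne_zero.2 h
      linarith
  have h := coeff_mul_pow_le_eval hnn (by linarith : (0 : ℝ) ≤ x) k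
  rw [hR, if_neg (by omega)] at h
  simp only [Polynomial.eval_add, Polynomial.eval_sub, Polynomial.eval_mul, Polynomial.eval_X,
    Polynomial.eval_C] at h
  have h2 : x ^ 2 ≤ x ^ k := pow_le_pow_right₀ hx hk
  have hk' : (2 : ℝ) ≤ k := by exact_mod_cast hk
  have h3 : 1 ≤ (k - 1 : ℝ) * P.coeff k := by nlinarith
  nlinarith [pow_nonneg (by linarith : (0 : ℝ) ≤ x) k]

theorem IsBranching.exists_isCharacteristic {P : Polynomial ℝ} (hP : IsBranching P) :
    ∃ ρ τ, IsCharacteristic P ρ τ := by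
  -- The second equation gives `ρ = 1 / P' τ`. Substituted into the first, it leaves one equation `E
  -- τ = 0`, solved by the intermediate value theorem on `[0, B]`.
  set D := fun x : ℝ => (Polynomial.derivative P).eval x with hD
  set E := fun x : ℝ => atomGen (D x)⁻¹ + (D x)⁻¹ * P.eval x - x with hE
  -- With this `B` one has `B ^ 2 - P 0 > 1`, which makes `E B` negative.
  set B := P.coeff 0 + 2 with hB
  have hB2 : 2 ≤ B := by have := hP.coeff_nonneg 0; linarith
  have hD2 : ∀ x, 0 ≤ x → 2 ≤ D x := fun x hx => hP.two_le_eval_derivative hx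
  have hDi : ∀ x, 0 ≤ x → 0 < (D x)⁻¹ ∧ (D x)⁻¹ ≤ 1 / 2 := fun x hx => by
    have := hD2 x hx
    refine ⟨by positivity, ?_⟩
    rw [one_div]
    exact inv_anti₀ (by norm_num) this
  have hc : ContinuousOn E (Set.Icc 0 B) := by
    have hDc : ContinuousOn (fun x => (D x)⁻¹) (Set.Icc 0 B) :=
      ContinuousOn.inv₀ (Polynomial.continuous _).continuousOn
        fun x hx => (lt_of_lt_of_le two_pos (hD2 x hx.1)).ne'
    refine ContinuousOn.sub (ContinuousOn.add ?_ (hDc.mul (Polynomial.continuous _).continuousOn))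
      continuousOn_id
    refine (hDc.pow 3).div ((continuousOn_const.sub hDc).pow 2) fun x hx => ?_
    have := hDi x hx.1
    exact pow_ne_zero _ (by linarith)
  have h0 : 0 < E 0 := by
    have h := hDi 0 le_rfl
    have h1 : 0 < 1 - (D 0)⁻¹ := by linarith
    have h2 : 0 ≤ P.eval 0 := eval_nonneg_of_coeff_nonneg hP.coeff_nonneg le_rfl
    simp only [hE, atomGen, sub_zero]
    have := h.1
    positivity
  have hEB : E B < 0 := by
    have h := hDi B (by linarith)
    have h1 := hP.sq_sub_le (x := B) (by linarith)
    have hD0 := hD2 B (by linarith)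
    set x := (D B)⁻¹ with hx
    have hxD : x * D B = 1 := inv_mul_cancel₀ (by linarith)
    have hatom : atomGen x ≤ x := by
      rw [atomGen, div_le_iff₀ (by have : 0 < 1 - x := by linarith
                                   positivity)]
      have : x ^ 2 ≤ (1 - x) ^ 2 := pow_le_pow_left₀ h.1.le (by linarith) 2
      nlinarith [h.1]
    have h4 : P.eval B ≤ B * D B - (B ^ 2 - P.coeff 0) := by simp only [hD]; linarith
    have h5 : x * P.eval B ≤ B - x * (B ^ 2 - P.coeff 0) := by
      have := mul_le_mul_of_nonneg_left h4 h.1.le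
      nlinarith
    have h6 : 1 < B ^ 2 - P.coeff 0 := by nlinarith
    have h7 : x * 1 < x * (B ^ 2 - P.coeff 0) := mul_lt_mul_of_pos_left h6 h.1
    simp only [hE]
    linarith
  obtain ⟨τ, hτ, hτ0⟩ := intermediate_value_Icc' (by linarith) hc ⟨hEB.le, h0.le⟩
  have hτpos : 0 < τ := lt_of_le_of_ne hτ.1 (by rintro rfl; linarith)
  have h := hDi τ hτ.1
  refine ⟨(D τ)⁻¹, τ, h.1, by linarith, hτpos, by simp only [hE] at hτ0; linarith, ?_⟩
  exact inv_mul_cancel₀ (by have := hD2 τ hτ.1; linarith)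

end DeBruijnFormula

/-! ### The solution as the fixed point of a contraction. -/

namespace DeBruijnFormula

/-- The right-hand side of the functional equation `y = atomGen z + z * P y`. -/
noncomputable def genMap (P : Polynomial ℝ) (z y : ℂ) : ℂ := atomGen z + z * Polynomial.aeval y P

/-- The iterates of `genMap P z`, started at `0`. -/
noncomputable def genIter (P : Polynomial ℝ) (n : ℕ) (z : ℂ) : ℂ := (genMap P z)^[n] 0

/-- The limit of the iterates of `genMap P z`. -/
noncomputable def genFix (P : Polynomial ℝ) (z : ℂ) : ℂ :=
  ∑' n, (genIter P (n + 1) z - genIter P n z)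

/-- The points `z` at which `genMap P z` is a contraction of the closed disk of radius `r`, with
constant `L`. -/
def contrSet (P : Polynomial ℝ) (r L : ℝ) : Set ℂ :=
  {z | ‖z‖ < 1 ∧ ‖(atomGen z : ℂ)‖ + ‖z‖ * P.eval r < r ∧
    ‖z‖ * (Polynomial.derivative P).eval r < L}

/-- The points `z` at which `genMap P z` is a contraction of a closed disk of radius at
most `τ`. -/
def contrDomain (P : Polynomial ℝ) (τ : ℝ) : Set ℂ :=
  {z | ∃ r L, 0 < r ∧ r ≤ τ ∧ 0 < L ∧ L < 1 ∧ z ∈ contrSet P r L}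

variable {P : Polynomial ℝ} {r L : ℝ} {z : ℂ}

theorem one_sub_ne_zero_of_norm_lt_one (hz : ‖z‖ < 1) : 1 - z ≠ 0 := by
  intro h
  rw [← sub_eq_zero.1 h] at hz
  simp at hz

theorem differentiableAt_atomGen (hz : ‖z‖ < 1) :
    DifferentiableAt ℂ (atomGen : ℂ → ℂ) z := by
  have := one_sub_ne_zero_of_norm_lt_one hz
  exact DifferentiableAt.div (by fun_prop) (by fun_prop) (pow_ne_zero _ this)

theorem isOpen_contrSet (P : Polynomial ℝ) (r L : ℝ) : IsOpen (contrSet P r L) := by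
  have h1 : ContinuousOn (fun z : ℂ => ‖(atomGen z : ℂ)‖ + ‖z‖ * P.eval r)
      (Metric.ball 0 1) := by
    refine ContinuousOn.add (ContinuousOn.norm fun z hz => ?_) (by fun_prop)
    exact (differentiableAt_atomGen (by simpa using hz)).continuousAt.continuousWithinAt
  have h2 := h1.isOpen_inter_preimage Metric.isOpen_ball (isOpen_Iio (a := r))
  have h3 : IsOpen {z : ℂ | ‖z‖ * (Polynomial.derivative P).eval r < L} :=
    isOpen_lt (by fun_prop) continuous_const
  convert h2.inter h3 using 1
  ext z
  simp [contrSet, and_assoc]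

theorem isOpen_contrDomain (P : Polynomial ℝ) (τ : ℝ) : IsOpen (contrDomain P τ) := by
  refine isOpen_iff_mem_nhds.2 fun z ⟨r, L, h0, h1, h2, h3, h4⟩ => ?_
  exact mem_of_superset ((isOpen_contrSet P r L).mem_nhds h4)
    fun w hw => ⟨r, L, h0, h1, h2, h3, hw⟩

theorem genIter_succ (P : Polynomial ℝ) (n : ℕ) (z : ℂ) :
    genIter P (n + 1) z = genMap P z (genIter P n z) := by
  simp [genIter, Function.iterate_succ_apply']

theorem norm_genMap_le (hP : IsBranching P) {y : ℂ} (hy : ‖y‖ ≤ r) :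
    ‖genMap P z y‖ ≤ ‖(atomGen z : ℂ)‖ + ‖z‖ * P.eval r := by
  refine (norm_add_le _ _).trans ?_
  rw [norm_mul]
  gcongr
  exact (norm_aeval_le_eval_norm hP.coeff_nonneg y).trans
    (eval_le_eval_of_coeff_nonneg hP.coeff_nonneg (norm_nonneg y) hy)

theorem norm_genMap_sub_le (hP : IsBranching P) {y y' : ℂ} (hy : ‖y‖ ≤ r) (hy' : ‖y'‖ ≤ r) :
    ‖genMap P z y - genMap P z y'‖ ≤
      ‖z‖ * (Polynomial.derivative P).eval r * ‖y - y'‖ := by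
  have : genMap P z y - genMap P z y' = z * (Polynomial.aeval y P - Polynomial.aeval y' P) := by
    simp only [genMap]; ring
  rw [this, norm_mul, mul_assoc]
  gcongr
  exact norm_aeval_sub_aeval_le hP.coeff_nonneg hy hy'

theorem eq_of_genMap_eq (hP : IsBranching P) {y y' : ℂ} (hy : ‖y‖ ≤ r) (hy' : ‖y'‖ ≤ r)
    (hz : ‖z‖ * (Polynomial.derivative P).eval r < 1) (h : genMap P z y = y)
    (h' : genMap P z y' = y') : y = y' := by
  by_contra hne
  have h1 := norm_genMap_sub_le hP (z := z) hy hy'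
  rw [h, h'] at h1
  have h2 : 0 < ‖y - y'‖ := norm_pos_iff.2 (sub_ne_zero.2 hne)
  nlinarith

theorem norm_genIter_le (hP : IsBranching P) (hr : 0 ≤ r) (hz : z ∈ contrSet P r L) (n : ℕ) :
    ‖genIter P n z‖ ≤ r := by
  induction n with
  | zero => simpa [genIter] using hr
  | succ n ih =>
    rw [genIter_succ]
    exact (norm_genMap_le hP ih).trans hz.2.1.le

theorem norm_genIter_succ_sub_le (hP : IsBranching P) (hr : 0 ≤ r) (hL : 0 < L)
    (hz : z ∈ contrSet P r L) (n : ℕ) :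
    ‖genIter P (n + 1) z - genIter P n z‖ ≤ L ^ n * r := by
  induction n with
  | zero => simpa [genIter] using norm_genIter_le hP hr hz 1
  | succ n ih =>
    rw [genIter_succ P (n + 1), genIter_succ P n, pow_succ', mul_assoc]
    rw [genIter_succ P n] at ih
    have h1 := norm_genMap_sub_le hP (z := z) (norm_genIter_le hP hr hz (n + 1))
      (norm_genIter_le hP hr hz n)
    rw [genIter_succ] at h1
    exact h1.trans (mul_le_mul hz.2.2.le ih (norm_nonneg _) hL.le)

theorem tendsto_genIter (hP : IsBranching P) (hr : 0 ≤ r) (hL : 0 < L) (hL1 : L < 1)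
    (hz : z ∈ contrSet P r L) : Tendsto (fun n => genIter P n z) atTop (𝓝 (genFix P z)) := by
  have hs : Summable fun n => genIter P (n + 1) z - genIter P n z :=
    Summable.of_norm_bounded ((summable_geometric_of_lt_one hL.le hL1).mul_right r)
      (norm_genIter_succ_sub_le hP hr hL hz)
  have h := hs.hasSum.tendsto_sum_nat
  simp only [Finset.sum_range_sub (fun n => genIter P n z)] at h
  simpa [genIter, genFix] using h

theorem norm_genFix_le (hP : IsBranching P) (hr : 0 ≤ r) (hL : 0 < L) (hL1 : L < 1)
    (hz : z ∈ contrSet P r L) : ‖genFix P z‖ ≤ r :=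
  le_of_tendsto (tendsto_genIter hP hr hL hL1 hz).norm
    (Eventually.of_forall (norm_genIter_le hP hr hz))

theorem genMap_genFix (hP : IsBranching P) (hr : 0 ≤ r) (hL : 0 < L) (hL1 : L < 1)
    (hz : z ∈ contrSet P r L) : genMap P z (genFix P z) = genFix P z := by
  have h := tendsto_genIter hP hr hL hL1 hz
  have hc : Continuous (genMap P z) :=
    continuous_const.add (continuous_const.mul (Polynomial.continuous_aeval P))
  have h1 := (hc.tendsto (genFix P z)).comp h
  have h2 := (tendsto_add_atTop_iff_nat 1).2 h
  simp only [genIter_succ] at h2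
  exact tendsto_nhds_unique h1 h2

theorem differentiableOn_genIter (P : Polynomial ℝ) (n : ℕ) :
    DifferentiableOn ℂ (genIter P n) (Metric.ball 0 1) := by
  induction n with
  | zero =>
    change DifferentiableOn ℂ (fun _ => (0 : ℂ)) _
    exact differentiableOn_const _
  | succ n ih =>
    have : genIter P (n + 1) = fun z => atomGen z + z * Polynomial.aeval (genIter P n z) P := by
      ext z; exact genIter_succ P n z
    rw [this]
    refine DifferentiableOn.add (fun z hz =>
      (differentiableAt_atomGen (by simpa using hz)).differentiableWithinAt)
      (differentiableOn_id.mul ?_)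
    exact (Polynomial.differentiable_aeval P).comp_differentiableOn ih

/-- On the open set `contrSet P r L` the telescoping series is dominated by `L ^ n * r`, so its sum
is holomorphic by Weierstrass. -/
theorem analyticOnNhd_genFix (hP : IsBranching P) (τ : ℝ) :
    AnalyticOnNhd ℂ (genFix P) (contrDomain P τ) := by
  rintro z ⟨r, L, hr, -, hL, hL1, hz⟩
  have hsub : contrSet P r L ⊆ Metric.ball 0 1 := fun w hw => by simpa using hw.1
  refine DifferentiableOn.analyticAt (s := contrSet P r L) ?_
    ((isOpen_contrSet P r L).mem_nhds hz)
  exact Complex.differentiableOn_tsum_of_summable_norm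
    ((summable_geometric_of_lt_one hL.le hL1).mul_right r)
    (fun n => ((differentiableOn_genIter P (n + 1)).sub (differentiableOn_genIter P n)).mono hsub)
    (isOpen_contrSet P r L) fun n w hw => norm_genIter_succ_sub_le hP hr.le hL hw n

theorem norm_genFix_le_of_mem (hP : IsBranching P) {τ : ℝ} (hz : z ∈ contrDomain P τ) :
    ‖genFix P z‖ ≤ τ := by
  obtain ⟨r, L, hr, hrτ, hL, hL1, hz⟩ := hz
  exact (norm_genFix_le hP hr.le hL hL1 hz).trans hrτ

theorem genMap_genFix_of_mem (hP : IsBranching P) {τ : ℝ} (hz : z ∈ contrDomain P τ) :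
    genMap P z (genFix P z) = genFix P z := by
  obtain ⟨r, L, hr, -, hL, hL1, hz⟩ := hz
  exact genMap_genFix hP hr.le hL hL1 hz

/-- Inside the disk the numerator is strictly smaller; on the circle, off `ρ`, the real part of `z`
is below `ρ`, so the denominator is strictly larger. This strictness is why no other point of the
circle is singular. -/
theorem norm_atomGen_lt {ρ : ℝ} (hρ0 : 0 < ρ) (hρ : ρ < 1) (hz : ‖z‖ ≤ ρ) (hzρ : z ≠ ρ) :
    ‖(atomGen z : ℂ)‖ < atomGen ρ := by
  have h1 : 1 - ρ ≤ ‖1 - z‖ := by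
    have := norm_sub_norm_le 1 z
    rw [norm_one] at this
    linarith
  rw [atomGen, atomGen, norm_div, norm_pow, norm_pow]
  have hpos : 0 < 1 - ρ := by linarith
  rcases hz.lt_or_eq with h | h
  · calc ‖z‖ ^ 3 / ‖1 - z‖ ^ 2 ≤ ‖z‖ ^ 3 / (1 - ρ) ^ 2 := by gcongr
      _ < ρ ^ 3 / (1 - ρ) ^ 2 := by gcongr
  · have h2 : 1 - ρ < ‖1 - z‖ := by
      have hre : z.re < ρ := by
        refine lt_of_le_of_ne ((Complex.re_le_norm z).trans hz) fun he => hzρ ?_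
        have him : z.im = 0 := by
          have h3 := Complex.sq_norm z
          rw [h, Complex.normSq_apply, he] at h3
          nlinarith
        exact Complex.ext (by simpa using he) (by simpa using him)
      have := Complex.re_le_norm (1 - z)
      simp only [Complex.sub_re, Complex.one_re] at this
      linarith
    rw [h]
    gcongr

/-- At radius `τ` the Lipschitz constant can equal one when `‖z‖ = ρ`. The strict inequality for
`atomGen` leaves room to shrink the radius to some `r < τ`, and there `ρ * P' r < ρ * P' τ = 1`. -/
theorem mem_contrDomain {ρ τ : ℝ} (hP : IsBranching P) (hc : IsCharacteristic P ρ τ)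
    (hz : ‖z‖ ≤ ρ) (hzρ : z ≠ ρ) : z ∈ contrDomain P τ := by
  have h1 : ‖(atomGen z : ℂ)‖ + ‖z‖ * P.eval τ < τ := by
    have := norm_atomGen_lt hc.pos hc.lt_one hz hzρ
    have h2 : ‖z‖ * P.eval τ ≤ ρ * P.eval τ :=
      mul_le_mul_of_nonneg_right hz (eval_nonneg_of_coeff_nonneg hP.coeff_nonneg hc.pos'.le)
    linarith [hc.eq]
  have h2 : ∀ᶠ r in 𝓝 τ, ‖(atomGen z : ℂ)‖ + ‖z‖ * P.eval r < r := by
    refine Tendsto.eventually_lt (f := fun r => ‖(atomGen z : ℂ)‖ + ‖z‖ * P.eval r) ?_ tendsto_id h1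
    exact tendsto_const_nhds.add (tendsto_const_nhds.mul ((Polynomial.continuous P).tendsto τ))
  have h3 : ∀ᶠ r in 𝓝[<] τ, 0 < r ∧ r < τ ∧ ‖(atomGen z : ℂ)‖ + ‖z‖ * P.eval r < r := by
    filter_upwards [nhdsWithin_le_nhds h2, nhdsWithin_le_nhds (lt_mem_nhds hc.pos'),
      self_mem_nhdsWithin] with r h h' h'' using ⟨h', h'', h⟩
  obtain ⟨r, hr0, hrτ, hr⟩ := h3.exists
  have h4 : ρ * (Polynomial.derivative P).eval r < 1 := by
    rw [← hc.deriv_eq]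
    refine mul_lt_mul_of_pos_left ?_ hc.pos
    obtain ⟨k, hk, hPk⟩ := hP.exists_one_le_coeff
    refine eval_lt_eval_of_coeff_nonneg (coeff_derivative_nonneg hP.coeff_nonneg) (j := k - 1)
      (by omega) ?_ hr0.le hrτ
    rw [Polynomial.coeff_derivative, Nat.sub_add_cancel (by omega)]
    positivity
  have h5 : ‖z‖ * (Polynomial.derivative P).eval r < 1 :=
    lt_of_le_of_lt (mul_le_mul_of_nonneg_right hz
      (by linarith [hP.two_le_eval_derivative hr0.le])) h4
  have h0 : 0 ≤ ‖z‖ * (Polynomial.derivative P).eval r :=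
    mul_nonneg (norm_nonneg z) (by linarith [hP.two_le_eval_derivative hr0.le])
  obtain ⟨L, hL, hL1⟩ := exists_between h5
  exact ⟨r, L, hr0, hrτ.le, lt_of_le_of_lt h0 hL, hL1, lt_of_le_of_lt hz hc.lt_one, hr, hL⟩

/-- For `‖z‖ < ρ` the Lipschitz constant `‖z‖ * P' τ` is below one, so fixed points are unique even
in the full disk of radius `τ`. This identifies both the sum over formulae and the local branch with
`genFix`. -/
theorem eq_genFix {ρ τ : ℝ} (hP : IsBranching P) (hc : IsCharacteristic P ρ τ) (hz : ‖z‖ < ρ)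
    {y : ℂ} (hy : ‖y‖ ≤ τ) (h : genMap P z y = y) : y = genFix P z := by
  have hzD : z ∈ contrDomain P τ := mem_contrDomain hP hc hz.le (by
    rintro rfl
    simp [abs_of_pos hc.pos] at hz)
  refine eq_of_genMap_eq hP hy (norm_genFix_le_of_mem hP hzD) ?_ h (genMap_genFix_of_mem hP hzD)
  rw [← hc.deriv_eq]
  exact mul_lt_mul_of_pos_right hz (by linarith [hP.two_le_eval_derivative hc.pos'.le])

end DeBruijnFormula

/-! ### The local branch at the singularity. -/

namespace DeBruijnFormula

theorem isInvertible_of_apply_one_ne_zero {f : ℂ →L[ℂ] ℂ} (hf : f 1 ≠ 0) : f.IsInvertible :=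
  ⟨ContinuousLinearEquiv.unitsEquivAut ℂ (Units.mk0 (f 1) hf), by ext; simp⟩

/-- A one-variable form of the analytic implicit function theorem. -/
theorem exists_analyticAt_implicit {H : ℂ × ℂ → ℂ} {u₀ d : ℂ} (hH : ContDiffAt ℂ ⊤ H (0, u₀))
    (h0 : H (0, u₀) = 0) (hd : HasDerivAt (fun u => H (0, u)) d u₀) (hd0 : d ≠ 0) :
    ∃ u : ℂ → ℂ, AnalyticAt ℂ u 0 ∧ u 0 = u₀ ∧ ∀ᶠ s in 𝓝 0, H (s, u s) = 0 := by
  have htop : (⊤ : WithTop ℕ∞) ≠ 0 := by simp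
  have hinv : (fderiv ℂ H (0, u₀) ∘L .inr ℂ ℂ ℂ).IsInvertible := by
    refine isInvertible_of_apply_one_ne_zero ?_
    have h1 : HasFDerivAt H (fderiv ℂ H (0, u₀)) (0, u₀) :=
      (hH.differentiableAt htop).hasFDerivAt
    have h2 : HasDerivAt (fun u : ℂ => ((0 : ℂ), u)) (0, 1) u₀ :=
      (hasDerivAt_const u₀ (0 : ℂ)).prodMk (hasDerivAt_id u₀)
    have h3 := h1.comp_hasDerivAt u₀ h2
    simpa [h3.unique hd] using hd0
  refine ⟨hH.implicitFunction htop hinv, ?_, hH.implicitFunction_apply_self htop hinv, ?_⟩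
  · exact (hH.contDiffAt_implicitFunction htop hinv).analyticAt
  · have := hH.eventually_apply_implicitFunction htop hinv
    rwa [h0] at this

variable {P : Polynomial ℝ} {ρ τ : ℝ}

/-- The difference quotient of `atomGen` at `ρ`. -/
noncomputable def atomGenQuot {K : Type*} [Field K] (ρ z : K) : K :=
  (ρ ^ 2 + ρ * z + z ^ 2 - 2 * ρ * z * (ρ + z) + ρ ^ 2 * z ^ 2) / ((1 - ρ) ^ 2 * (1 - z) ^ 2)

theorem atomGen_sub_atomGen {K : Type*} [Field K] {ρ z : K} (hρ : 1 - ρ ≠ 0) (hz : 1 - z ≠ 0) :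
    atomGen ρ - atomGen z = (ρ - z) * atomGenQuot ρ z := by
  rw [atomGen, atomGen, atomGenQuot]
  field_simp
  ring

theorem atomGenQuot_self_pos (hρ : 0 < ρ) (hρ1 : ρ < 1) : 0 < atomGenQuot ρ ρ := by
  have h : 0 < 1 - ρ := by linarith
  rw [atomGenQuot]
  refine div_pos ?_ (by positivity)
  have : ρ ^ 2 + ρ * ρ + ρ ^ 2 - 2 * ρ * ρ * (ρ + ρ) + ρ ^ 2 * ρ ^ 2 =
      ρ ^ 2 * ((1 - ρ) * (3 - ρ)) := by ring
  rw [this]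
  have : 0 < 3 - ρ := by linarith
  positivity

/-- Near `ρ` the functional equation is solved by an analytic function of `s`, where
`z = ρ (1 - s ^ 2)`. -/
theorem exists_branch (hP : IsBranching P) (hc : IsCharacteristic P ρ τ) :
    ∃ (u : ℂ → ℂ) (b : ℝ), 0 < b ∧ AnalyticAt ℂ u 0 ∧ u 0 = b ∧
      ∀ᶠ s in 𝓝 0, genMap P (ρ * (1 - s ^ 2)) (τ - s * u s) = τ - s * u s := by
  obtain ⟨j, hj, hPj⟩ := hP.exists_one_le_coeff
  obtain ⟨T, hT0, hT⟩ := exists_second_order_taylor hP.coeff_nonneg hj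
    (by linarith : 0 < P.coeff j) hc.pos'
  have hρ0 := hc.pos
  have hρC : (1 : ℂ) - ρ ≠ 0 := by
    have h : (1 : ℝ) - ρ ≠ 0 := by linarith [hc.lt_one]
    exact_mod_cast h
  -- After the substitution, the characteristic equations cancel the terms of order zero and one in
  -- `s`. What is left of `genMap P z y - y` is `-s ^ 2 * H (s, u)`.
  set H : ℂ × ℂ → ℂ := fun p => ρ * atomGenQuot (ρ : ℂ) (ρ * (1 - p.1 ^ 2)) +
    ρ * (P.eval τ : ℝ) - p.1 * p.2 -
      ρ * (1 - p.1 ^ 2) * p.2 ^ 2 * Polynomial.aeval (-(p.1 * p.2)) T with hH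
  set A : ℝ := atomGenQuot ρ ρ + P.eval τ with hA
  have hApos : 0 < A := add_pos_of_pos_of_nonneg (atomGenQuot_self_pos hc.pos hc.lt_one)
    (eval_nonneg_of_coeff_nonneg hP.coeff_nonneg hc.pos'.le)
  have hquot : atomGenQuot (ρ : ℂ) ρ = (atomGenQuot ρ ρ : ℝ) := by simp [atomGenQuot]
  have hTC : Polynomial.aeval (0 : ℂ) T = (T.eval 0 : ℝ) := by
    rw [← Complex.ofReal_zero, ← Complex.coe_algebraMap, Polynomial.aeval_algebraMap_apply]
    simp
  have hHu : ∀ u, H (0, u) = ρ * A - ρ * u ^ 2 * (T.eval 0 : ℝ) := by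
    intro u
    simp only [hH, hA]
    norm_num
    rw [hTC, hquot]
    ring
  -- The positive root of `H (0, u) = ρ (A - T 0 * u ^ 2)`; it is simple, as the implicit function
  -- theorem requires.
  set b := √(A / T.eval 0) with hb
  have hbpos : 0 < b := Real.sqrt_pos.2 (div_pos hApos hT0)
  have hb2 : b ^ 2 * T.eval 0 = A := by
    rw [hb, Real.sq_sqrt (div_pos hApos hT0).le, div_mul_cancel₀ _ hT0.ne']
  have hcd : ContDiffAt ℂ ⊤ H (0, (b : ℂ)) := by
    have h1 : ContDiffAt ℂ ⊤ (fun p : ℂ × ℂ => atomGenQuot (ρ : ℂ) (ρ * (1 - p.1 ^ 2)))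
        (0, (b : ℂ)) := by
      refine ContDiffAt.div (by fun_prop) (by fun_prop) ?_
      simpa using hρC
    have h2 : ContDiffAt ℂ ⊤ (fun p : ℂ × ℂ => Polynomial.aeval (-(p.1 * p.2)) T)
        (0, (b : ℂ)) := by
      have := (Polynomial.contDiff_aeval (𝕜 := ℂ) T ⊤).contDiffAt (x := -((0 : ℂ) * b))
      exact ContDiffAt.comp (f := fun p : ℂ × ℂ => -(p.1 * p.2)) (0, (b : ℂ)) this (by fun_prop)
    fun_prop
  have hd : HasDerivAt (fun u => H (0, u)) (-(2 * ρ * b * (T.eval 0 : ℝ))) (b : ℂ) := by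
    simp only [hHu]
    refine HasDerivAt.congr_deriv (((((hasDerivAt_id (b : ℂ)).fun_pow 2).const_mul
      (ρ : ℂ)).mul_const ((T.eval 0 : ℝ) : ℂ)).const_sub ((ρ : ℂ) * A)) ?_
    push_cast [id]
    ring
  obtain ⟨u, hu, hu0, hev⟩ := exists_analyticAt_implicit hcd
    (by rw [hHu, ← hb2]; push_cast; ring) hd (by
      have : 2 * ρ * b * T.eval 0 ≠ 0 := by positivity
      rw [neg_ne_zero]
      exact_mod_cast this)
  refine ⟨u, b, hbpos, hu, hu0, ?_⟩
  have hne : ∀ᶠ s : ℂ in 𝓝 0, 1 - (ρ : ℂ) * (1 - s ^ 2) ≠ 0 := by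
    refine ContinuousAt.eventually_ne (by fun_prop) ?_
    simpa using hρC
  filter_upwards [hev, hne] with s hs hs1
  have e1 := atomGen_sub_atomGen hρC hs1
  have e2 := hT (-(s * u s))
  have e3 : (atomGen (ρ : ℂ) : ℂ) + ρ * (P.eval τ : ℝ) = τ := by
    have := congrArg ((↑) : ℝ → ℂ) hc.eq
    simpa [atomGen] using this
  have e4 : (ρ : ℂ) * ((Polynomial.derivative P).eval τ : ℝ) = 1 := by
    exact_mod_cast congrArg ((↑) : ℝ → ℂ) hc.deriv_eq
  simp only [hH] at hs
  rw [genMap, sub_eq_add_neg (τ : ℂ), e2]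
  linear_combination (-s ^ 2) * hs - e1 + e3 - (1 - s ^ 2) * (s * u s) * e4

end DeBruijnFormula

/-! ### Continuation to a slit disk. -/

namespace DeBruijnFormula

section SlitDisk

variable {ρ : ℝ}

theorem isOpen_slitDisk (ρ R : ℝ) : IsOpen (slitDisk ρ R) := by
  have h1 : IsOpen {z : ℂ | ‖z‖ < R} := isOpen_lt continuous_norm continuous_const
  have h2 : IsClosed {z : ℂ | ρ ≤ z.re ∧ z.im = 0} :=
    (isClosed_le continuous_const Complex.continuous_re).inter
      (isClosed_eq Complex.continuous_im continuous_const)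
  exact h1.inter h2.isOpen_compl

/-- An analytic function on a neighbourhood of the closed disk without the point `ρ`, and an
analytic function on a slit neighbourhood of `ρ` that agrees with it in the disk, can be glued. -/
theorem exists_analytic_glue {f q : ℂ → ℂ} {D : Set ℂ} {ε : ℝ} (hρ : 0 < ρ) (hD : IsOpen D)
    (hDρ : ∀ z : ℂ, ‖z‖ ≤ ρ → z ≠ ρ → z ∈ D) (hf : AnalyticOnNhd ℂ f D) (hε : 0 < ε)
    (hq : ∀ z : ℂ, ‖z - ρ‖ < ε → ¬ (ρ ≤ z.re ∧ z.im = 0) → AnalyticAt ℂ q z)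
    (hfq : ∀ z : ℂ, ‖z‖ < ρ → ‖z - ρ‖ < ε → f z = q z) :
    ∃ R : ℝ, ρ < R ∧ ∃ g : ℂ → ℂ, AnalyticOnNhd ℂ g (slitDisk ρ R) ∧
      (∀ z : ℂ, ‖z‖ < ρ → g z = f z) ∧ ∀ᶠ z : ℂ in 𝓝 (ρ : ℂ), g z = q z := by
  set δ := min ε ρ / 2 with hδ
  have hδ0 : 0 < δ := by have := lt_min hε hρ; linarith
  have hδε : 2 * δ ≤ ε := by have := min_le_left ε ρ; linarith
  have hδρ : 2 * δ ≤ ρ := by have := min_le_right ε ρ; linarith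
  -- `D` and a small ball at `ρ` cover the compact closed disk, hence also a slightly larger disk.
  obtain ⟨η, hη, hηs⟩ := (isCompact_closedBall (0 : ℂ) ρ).exists_thickening_subset_open
    (hD.union (Metric.isOpen_ball (x := (ρ : ℂ)) (ε := δ / 2))) (fun z hz => by
      by_cases h : z = ρ
      · right; rw [h]; exact Metric.mem_ball_self (by linarith)
      · left; exact hDρ z (by simpa using hz) h)
  rw [thickening_closedBall hη hρ.le] at hηs
  set R := ρ + min η (δ / 8) with hR
  have hmin : 0 < min η (δ / 8) := lt_min hη (by linarith)
  have hRη : R ≤ η + ρ := by have := min_le_left η (δ / 8); linarith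
  have hRδ : R ≤ ρ + δ / 8 := by have := min_le_right η (δ / 8); linarith
  have hmemD : ∀ z : ℂ, ‖z‖ < R → δ / 2 ≤ ‖z - ρ‖ → z ∈ D := by
    intro z hz hz'
    rcases hηs (show z ∈ Metric.ball (0 : ℂ) (η + ρ) by simpa using hz.trans_le hRη) with h | h
    · exact h
    · rw [Metric.mem_ball, dist_eq_norm] at h
      linarith
  -- In an annulus around `ρ`, a point `w` outside the disk is joined to the disk by a radial
  -- segment. The segment has length below `δ / 4`, so it stays in `D` and in the domain of `q`; it
  -- avoids the slit because `w` does. The identity theorem carries the equality `f = q` along it.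
  have hagree : ∀ w ∈ slitDisk ρ R, 3 * δ / 4 < ‖w - ρ‖ → ‖w - ρ‖ < δ → q w = f w := by
    intro w hw h1 h2
    rcases lt_or_ge ‖w‖ ρ with hlt | hge
    · exact (hfq w hlt (by linarith)).symm
    have hw0 : 0 < ‖w‖ := hρ.trans_le hge
    set t₀ := (ρ - δ / 8) / ‖w‖ with ht₀
    have ht₀w : t₀ * ‖w‖ = ρ - δ / 8 := div_mul_cancel₀ _ hw0.ne'
    have ht₀0 : 0 < t₀ := div_pos (by linarith) hw0
    have ht₀1 : t₀ ≤ 1 := (div_le_one hw0).2 (by linarith)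
    set S := (fun t : ℝ => (t : ℂ) * w) '' Set.Icc t₀ 1 with hS
    have hSp : IsPreconnected S := isPreconnected_Icc.image _ (by fun_prop)
    have hnorm : ∀ t ∈ Set.Icc t₀ 1, ‖(t : ℂ) * w‖ ≤ ‖w‖ ∧ ‖(t : ℂ) * w - w‖ < δ / 4 := by
      intro t ht
      have ht0 : 0 < t := ht₀0.trans_le ht.1
      constructor
      · rw [norm_mul, Complex.norm_real, Real.norm_of_nonneg ht0.le]
        exact mul_le_of_le_one_left hw0.le ht.2
      · have h3 : (t : ℂ) * w - w = -(((1 - t : ℝ) : ℂ) * w) := by push_cast; ring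
        rw [h3, norm_neg, norm_mul, Complex.norm_real, Real.norm_of_nonneg (by linarith [ht.2])]
        have h4 := mul_le_mul_of_nonneg_right ht.1 hw0.le
        have h5 : ‖w‖ < R := hw.1
        linarith
    have hdist : ∀ t ∈ Set.Icc t₀ 1, δ / 2 ≤ ‖(t : ℂ) * w - ρ‖ ∧ ‖(t : ℂ) * w - ρ‖ < ε := by
      intro t ht
      have h3 := (hnorm t ht).2
      have h4 := norm_add_le ((t : ℂ) * w - w) (w - ρ)
      have h5 := norm_sub_le ((t : ℂ) * w - ρ) ((t : ℂ) * w - w)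
      rw [sub_add_sub_cancel] at h4
      rw [sub_sub_sub_cancel_left] at h5
      constructor <;> linarith
    have hfS : AnalyticOnNhd ℂ f S := by
      rintro _ ⟨t, ht, rfl⟩
      exact hf _ (hmemD _ ((hnorm t ht).1.trans_lt hw.1) (hdist t ht).1)
    have hqS : AnalyticOnNhd ℂ q S := by
      rintro _ ⟨t, ht, rfl⟩
      refine hq _ (hdist t ht).2 fun h => hw.2 ?_
      simp only [Complex.mul_re, Complex.mul_im, Complex.ofReal_re, Complex.ofReal_im, zero_mul,
        sub_zero, add_zero] at h
      have ht0 : 0 < t := ht₀0.trans_le ht.1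
      have him : w.im = 0 := by simpa [ht0.ne'] using h.2
      refine ⟨?_, him⟩
      nlinarith [h.1, ht.2]
    refine hqS.eqOn_of_preconnected_of_eventuallyEq hfS hSp (z₀ := (t₀ : ℂ) * w)
      ⟨t₀, ⟨le_rfl, ht₀1⟩, rfl⟩ ?_ ⟨1, ⟨ht₀1, le_rfl⟩, by simp⟩
    have h6 : ∀ᶠ z : ℂ in 𝓝 ((t₀ : ℂ) * w), ‖z‖ < ρ := by
      refine continuous_norm.continuousAt.eventually_lt continuousAt_const ?_
      rw [norm_mul, Complex.norm_real, Real.norm_of_nonneg ht₀0.le, ht₀w]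
      linarith
    have h7 : ∀ᶠ z : ℂ in 𝓝 ((t₀ : ℂ) * w), ‖z - ρ‖ < ε :=
      ContinuousAt.eventually_lt (by fun_prop) continuousAt_const (hdist t₀ ⟨le_rfl, ht₀1⟩).2
    filter_upwards [h6, h7] with z hz hz' using (hfq z hz hz').symm
  classical
  refine ⟨R, by linarith, fun z => if ‖z - ρ‖ < δ then q z else f z, ?_, ?_, ?_⟩
  · intro z hz
    rcases lt_or_ge ‖z - ρ‖ δ with h | h
    · refine (hq z (by linarith) hz.2).congr ?_
      have : ∀ᶠ w : ℂ in 𝓝 z, ‖w - ρ‖ < δ :=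
        ContinuousAt.eventually_lt (by fun_prop) continuousAt_const h
      filter_upwards [this] with w hw
      rw [if_pos hw]
    · refine (hf z (hmemD z hz.1 (by linarith))).congr ?_
      have : ∀ᶠ w : ℂ in 𝓝 z, 3 * δ / 4 < ‖w - ρ‖ :=
        continuousAt_const.eventually_lt (by fun_prop) (by linarith)
      filter_upwards [this, (isOpen_slitDisk ρ R).mem_nhds hz] with w hw hw'
      split_ifs with h'
      · exact (hagree w hw' hw h').symm
      · rfl
  · intro z hz
    beta_reduce
    split_ifs with h
    · exact (hfq z hz (by linarith)).symm
    · rfl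
  · have : ∀ᶠ w : ℂ in 𝓝 (ρ : ℂ), ‖w - ρ‖ < δ :=
      ContinuousAt.eventually_lt (by fun_prop) continuousAt_const (by simpa using hδ0)
    filter_upwards [this] with w hw
    rw [if_pos hw]

/-- The square root that governs the behaviour at the singularity `ρ`. -/
noncomputable def singRoot (ρ : ℝ) (z : ℂ) : ℂ := (1 - z / ρ) ^ (1 / 2 : ℂ)

theorem singRoot_sq (ρ : ℝ) (z : ℂ) : singRoot ρ z ^ 2 = 1 - z / ρ := by
  rw [singRoot, one_div]
  exact Complex.cpow_ofNat_inv_pow _ 2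

theorem norm_singRoot_sq (ρ : ℝ) (z : ℂ) : ‖singRoot ρ z‖ ^ 2 = ‖1 - z / (ρ : ℂ)‖ := by
  rw [← norm_pow, singRoot_sq]

theorem analyticAt_singRoot (hρ : 0 < ρ) {z : ℂ} (hz : ¬ (ρ ≤ z.re ∧ z.im = 0)) :
    AnalyticAt ℂ (singRoot ρ) z := by
  refine AnalyticAt.cpow (by fun_prop) analyticAt_const ?_
  rw [Complex.mem_slitPlane_iff]
  by_contra! h
  refine hz ?_
  simpa [Complex.div_ofReal_re, Complex.div_ofReal_im, hρ.ne', one_le_div hρ] using h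

theorem tendsto_singRoot (hρ : 0 < ρ) : Tendsto (singRoot ρ) (𝓝 (ρ : ℂ)) (𝓝 0) := by
  have h1 : ContinuousAt (fun x : ℂ => x ^ (1 / 2 : ℂ)) (1 - (ρ : ℂ) / ρ) :=
    Complex.continuousAt_cpow_const_of_re_pos (by simp [hρ.ne']) (by norm_num)
  have h2 : ContinuousAt (singRoot ρ) ρ :=
    ContinuousAt.comp (f := fun z : ℂ => 1 - z / (ρ : ℂ)) h1 (by fun_prop)
  simpa [ContinuousAt, singRoot, hρ.ne'] using h2

theorem singRoot_mul_one_sub_sq (hρ : 0 < ρ) {s : ℝ} (hs : 0 ≤ s) :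
    singRoot ρ (ρ * (1 - s ^ 2)) = s := by
  have hρC : (ρ : ℂ) ≠ 0 := by exact_mod_cast hρ.ne'
  have h1 : 1 - (ρ : ℂ) * (1 - s ^ 2) / ρ = ((s ^ 2 : ℝ) : ℂ) := by
    field_simp
    push_cast
    ring
  have h2 : (1 / 2 : ℂ) = ((1 / 2 : ℝ) : ℂ) := by norm_num
  rw [singRoot, h1, h2, ← Complex.ofReal_cpow (sq_nonneg s), ← Real.sqrt_eq_rpow, Real.sqrt_sq hs]

theorem mul_one_sub_singRoot_sq (hρ : 0 < ρ) (z : ℂ) : ρ * (1 - singRoot ρ z ^ 2) = z := by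
  have hρC : (ρ : ℂ) ≠ 0 := by exact_mod_cast hρ.ne'
  rw [singRoot_sq]
  field_simp
  ring

end SlitDisk

variable {P : Polynomial ℝ} {ρ τ : ℝ}

theorem exists_genFix_eq_comp_singRoot (hP : IsBranching P) (hc : IsCharacteristic P ρ τ) :
    ∃ (ψ : ℂ → ℂ) (b ε : ℝ), 0 < b ∧ 0 < ε ∧ AnalyticAt ℂ ψ 0 ∧ ψ 0 = τ ∧ deriv ψ 0 = -b ∧
      (∀ z : ℂ, ‖z - ρ‖ < ε → ¬ (ρ ≤ z.re ∧ z.im = 0) →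
        AnalyticAt ℂ (fun z => ψ (singRoot ρ z)) z) ∧
      ∀ z : ℂ, ‖z‖ < ρ → ‖z - ρ‖ < ε → genFix P z = ψ (singRoot ρ z) := by
  obtain ⟨u, b, hb, hu, hu0, hsol⟩ := exists_branch hP hc
  set ψ : ℂ → ℂ := fun s => τ - s * u s with hψ
  have hψa : AnalyticAt ℂ ψ 0 := by fun_prop
  have hψd : HasDerivAt ψ (-b) 0 := by
    refine (((hasDerivAt_id (0 : ℂ)).fun_mul hu.differentiableAt.hasDerivAt).const_sub
      (τ : ℂ)).congr_deriv ?_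
    simp [hu0]
  have hlocal : ∀ᶠ z : ℂ in 𝓝 (ρ : ℂ), AnalyticAt ℂ ψ (singRoot ρ z) ∧
      genMap P z (ψ (singRoot ρ z)) = ψ (singRoot ρ z) := by
    filter_upwards [(tendsto_singRoot hc.pos).eventually hψa.eventually_analyticAt,
      (tendsto_singRoot hc.pos).eventually hsol] with z h1 h2
    rw [mul_one_sub_singRoot_sq hc.pos] at h2
    exact ⟨h1, h2⟩
  obtain ⟨ε, hε, hball⟩ := Metric.eventually_nhds_iff.1 hlocal
  have hanalytic : ∀ z : ℂ, ‖z - ρ‖ < ε → ¬ (ρ ≤ z.re ∧ z.im = 0) →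
      AnalyticAt ℂ (fun z => ψ (singRoot ρ z)) z := fun z hz hz' =>
    (hball (by rwa [dist_eq_norm])).1.comp (analyticAt_singRoot hc.pos hz')
  have hslit : ∀ z : ℂ, ‖z‖ < ρ → ¬ (ρ ≤ z.re ∧ z.im = 0) := fun z hz h => by
    have := Complex.re_le_norm z
    linarith [h.1]
  refine ⟨ψ, b, ε, hb, hε, hψa, by simp [hψ], hψd.deriv, hanalytic, fun z hz hz' => ?_⟩
  -- The sign of `b` selects the branch: `ψ s ≈ τ - b s` has norm below `τ` for small `s > 0`, so
  -- `eq_genFix` applies near `ρ (1 - s ^ 2)`. The identity theorem on the convex set `W` does the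
  -- rest.
  have hpos : ∀ᶠ s : ℝ in 𝓝[>] (0 : ℝ), ‖ψ s‖ < τ := by
    have h1 : Tendsto (fun s : ℝ => u s) (𝓝[>] 0) (𝓝 (b : ℂ)) := by
      rw [← hu0]
      have h : Tendsto (fun s : ℝ => (s : ℂ)) (𝓝[>] 0) (𝓝 0) :=
        (Complex.continuous_ofReal.tendsto' 0 0 (by simp)).mono_left nhdsWithin_le_nhds
      exact hu.continuousAt.tendsto.comp h
    have h2 : ∀ᶠ s : ℝ in 𝓝[>] 0, ‖u s - b‖ < b / 2 := by
      have := (Metric.tendsto_nhds.1 h1) (b / 2) (by linarith)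
      simpa only [dist_eq_norm] using this
    have h3 : ∀ᶠ s : ℝ in 𝓝[>] 0, s < τ / b :=
      nhdsWithin_le_nhds (gt_mem_nhds (div_pos hc.pos' hb))
    filter_upwards [h2, h3, self_mem_nhdsWithin] with s hs2 hs3 hs0
    have hs0 : 0 < s := hs0
    rw [lt_div_iff₀ hb] at hs3
    have e1 : ψ s = ((τ - s * b : ℝ) : ℂ) - s * (u s - b) := by
      simp only [hψ]; push_cast; ring
    rw [e1]
    refine (norm_sub_le _ _).trans_lt ?_
    rw [norm_mul, Complex.norm_real, Complex.norm_real, Real.norm_of_nonneg hs0.le,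
      Real.norm_of_nonneg (by linarith)]
    nlinarith
  have hnear : ∀ᶠ s : ℝ in 𝓝[>] 0, ‖(ρ : ℂ) * (1 - (s : ℂ) ^ 2) - ρ‖ < ε ∧ s < 1 := by
    refine nhdsWithin_le_nhds (Eventually.and ?_ (gt_mem_nhds one_pos))
    exact ContinuousAt.eventually_lt (by fun_prop) continuousAt_const (by simpa using hε)
  obtain ⟨s, hs1, ⟨hs2, hs3⟩, hs0⟩ := (hpos.and (hnear.and self_mem_nhdsWithin)).exists
  have hs0 : 0 < s := hs0
  set x : ℂ := ρ * (1 - (s : ℂ) ^ 2) with hx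
  have hxρ : ‖x‖ < ρ := by
    have h4 : x = ((ρ * (1 - s ^ 2) : ℝ) : ℂ) := by simp [hx]
    have h5 := hc.pos
    have h6 : s ^ 2 < 1 := by nlinarith
    rw [h4, Complex.norm_real, Real.norm_of_nonneg (mul_nonneg h5.le (by linarith))]
    nlinarith [mul_pos h5 (pow_pos hs0 2)]
  set W := Metric.ball (0 : ℂ) ρ ∩ Metric.ball (ρ : ℂ) ε with hW
  have hWmem : ∀ z : ℂ, z ∈ W ↔ ‖z‖ < ρ ∧ ‖z - ρ‖ < ε := fun z => by
    simp [hW, dist_eq_norm]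
  have hWp : IsPreconnected W :=
    ((convex_ball (0 : ℂ) ρ).inter (convex_ball (ρ : ℂ) ε)).isPreconnected
  have hWo : IsOpen W := Metric.isOpen_ball.inter Metric.isOpen_ball
  have hxW : x ∈ W := (hWmem x).2 ⟨hxρ, hs2⟩
  have hf : AnalyticOnNhd ℂ (genFix P) W := fun w hw =>
    analyticOnNhd_genFix hP τ w (mem_contrDomain hP hc ((hWmem w).1 hw).1.le (by
      rintro rfl
      have := ((hWmem _).1 hw).1
      simp [abs_of_pos hc.pos] at this))
  have hq : AnalyticOnNhd ℂ (fun z => ψ (singRoot ρ z)) W := fun w hw =>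
    hanalytic w ((hWmem w).1 hw).2 (hslit w ((hWmem w).1 hw).1)
  refine hf.eqOn_of_preconnected_of_eventuallyEq hq hWp hxW ?_ ((hWmem z).2 ⟨hz, hz'⟩)
  have hlt : ∀ᶠ w : ℂ in 𝓝 x, ‖ψ (singRoot ρ w)‖ < τ := by
    refine (hq x hxW).continuousAt.norm.eventually_lt continuousAt_const ?_
    simpa only [hx, singRoot_mul_one_sub_sq hc.pos hs0.le] using hs1
  filter_upwards [hlt, hWo.mem_nhds hxW] with w hw1 hw2
  have hw2 := (hWmem w).1 hw2
  exact (eq_genFix hP hc hw2.1 hw1.le (hball (by rw [dist_eq_norm]; exact hw2.2)).2).symm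

theorem exists_slitDisk_continuation (hP : IsBranching P) (hc : IsCharacteristic P ρ τ) :
    ∃ (ψ : ℂ → ℂ) (b R : ℝ) (g : ℂ → ℂ), 0 < b ∧ ρ < R ∧ AnalyticAt ℂ ψ 0 ∧ ψ 0 = τ ∧
      deriv ψ 0 = -b ∧ AnalyticOnNhd ℂ g (slitDisk ρ R) ∧
      (∀ z : ℂ, ‖z‖ < ρ → g z = genFix P z) ∧ ∀ᶠ z : ℂ in 𝓝 (ρ : ℂ), g z = ψ (singRoot ρ z) := by
  obtain ⟨ψ, b, ε, hb, hε, hψ, hψ0, hψ1, hq, hfq⟩ := exists_genFix_eq_comp_singRoot hP hc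
  obtain ⟨R, hR, g, hg, hgf, hgq⟩ := exists_analytic_glue hc.pos (isOpen_contrDomain P τ)
    (fun z hz hz' => mem_contrDomain hP hc hz hz') (analyticOnNhd_genFix hP τ) hε hq hfq
  exact ⟨ψ, b, R, g, hb, hR, hψ, hψ0, hψ1, hg, hgf, hgq⟩

end DeBruijnFormula

/-! ### The generating function of formulae and its functional equation. -/

namespace DeBruijnFormula

open scoped ENNReal

section FinTuples

variable {α : Type*}

theorem ennreal_tsum_prod_fin (f : α → ℝ≥0∞) (k : ℕ) :
    ∑' a : Fin k → α, ∏ j, f (a j) = (∑' a, f a) ^ k := by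
  induction k with
  | zero => simp
  | succ k ih =>
    rw [← (Fin.consEquiv fun _ : Fin (k + 1) => α).tsum_eq, ENNReal.tsum_prod', pow_succ', ← ih,
      ← ENNReal.tsum_mul_right]
    refine tsum_congr fun a => ?_
    rw [← ENNReal.tsum_mul_left]
    exact tsum_congr fun b => by simp [Fin.consEquiv, Fin.prod_univ_succ]

theorem hasSum_prod_fin {f : α → ℂ} (hf : Summable fun a => ‖f a‖) (k : ℕ) :
    (Summable fun a : Fin k → α => ‖∏ j, f (a j)‖) ∧
      HasSum (fun a : Fin k → α => ∏ j, f (a j)) ((∑' a, f a) ^ k) := by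
  induction k with
  | zero => exact ⟨Summable.of_finite, by simp⟩
  | succ k ih =>
    have h1 := hf.mul_norm ih.1
    have h2 := tsum_mul_tsum_of_summable_norm hf ih.1
    rw [ih.2.tsum_eq, ← pow_succ'] at h2
    have h3 : ∀ p : α × (Fin k → α), ∏ j, f (Fin.consEquiv (fun _ => α) p j) =
        f p.1 * ∏ j, f (p.2 j) := fun p => by simp [Fin.consEquiv, Fin.prod_univ_succ]
    constructor
    · rw [← (Fin.consEquiv fun _ : Fin (k + 1) => α).summable_iff]
      simpa only [Function.comp_def, h3] using h1
    · rw [← (Fin.consEquiv fun _ : Fin (k + 1) => α).hasSum_iff, h2]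
      simpa only [Function.comp_def, h3] using h1.of_norm.hasSum

end FinTuples

variable {ι : Type*}

/-- A formula is an atom, a quantified formula or a connective applied to formulae. -/
def formulaEquiv (ar : ι → ℕ) :
    (ℕ × ℕ) ⊕ (Formula ar ⊕ (Formula ar ⊕ (Σ i, Fin (ar i) → Formula ar))) ≃ Formula ar where
  toFun
    | .inl p => .mem p.1 p.2
    | .inr (.inl φ) => .all φ
    | .inr (.inr (.inl φ)) => .ex φ
    | .inr (.inr (.inr p)) => .conn p.1 p.2
  invFun
    | .mem n m => .inl (n, m)
    | .all φ => .inr (.inl φ)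
    | .ex φ => .inr (.inr (.inl φ))
    | .conn i args => .inr (.inr (.inr ⟨i, args⟩))
  left_inv x := by rcases x with p | φ | φ | p <;> rfl
  right_inv φ := by cases φ <;> rfl

/-- The polynomial `2 X + ∑ i, X ^ ar i`. -/
noncomputable def branchPoly [Fintype ι] (ar : ι → ℕ) : Polynomial ℝ :=
  2 * Polynomial.X + ∑ i, Polynomial.X ^ ar i

/-- If all arities are at most one, every expressible function depends on a single variable, by
induction on the term. Conjunction of two variables does not. -/
theorem exists_two_le_arity {ar : ι → ℕ} {tt : ∀ i, (Fin (ar i) → Bool) → Bool}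
    (hF : FunctionallyComplete tt) : ∃ i, 2 ≤ ar i := by
  by_contra! hlt
  have key : ∀ f : (Fin 2 → Bool) → Bool, Expressible tt 2 f →
      ∃ k : Fin 2, ∀ v w, v k = w k → f v = f w := by
    intro f hf
    induction hf with
    | var k => exact ⟨k, fun v w h => h⟩
    | comp i g hg ih =>
      rcases Nat.lt_or_ge 0 (ar i) with h | h
      · obtain ⟨k, hk⟩ := ih ⟨0, h⟩
        refine ⟨k, fun v w hvw => congrArg (tt i) (funext fun j => ?_)⟩
        have hj : j = ⟨0, h⟩ := Fin.ext (by have := hlt i; have := j.2; simp; omega)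
        rw [hj]
        exact hk v w hvw
      · exact ⟨0, fun v w _ => congrArg (tt i) (funext fun j => absurd j.2 (by omega))⟩
  obtain ⟨k, hk⟩ := key _ (hF 2 (by norm_num) fun v => v 0 && v 1)
  -- The two valuations agree at `k`, but conjunction is true on the first and false on the second.
  have h := hk (fun _ => true) (fun j => decide (j = k)) (by simp)
  fin_cases k <;> simp at h

theorem isBranching_branchPoly [Fintype ι] {ar : ι → ℕ} (har : ∃ i, 2 ≤ ar i) :
    IsBranching (branchPoly ar) := by
  have h0 : ∀ k i, 0 ≤ ((Polynomial.X : Polynomial ℝ) ^ ar i).coeff k := fun k i => by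
    rw [Polynomial.coeff_X_pow]; positivity
  have h1 : ∀ k, (branchPoly ar).coeff k = 2 * (if k = 1 then 1 else 0) +
      ∑ i, ((Polynomial.X : Polynomial ℝ) ^ ar i).coeff k := fun k => by
    rw [branchPoly, Polynomial.coeff_add, Polynomial.finsetSum_coeff, two_mul,
      Polynomial.coeff_add, Polynomial.coeff_X, two_mul]
    simp only [eq_comm]
  refine ⟨fun k => ?_, ?_, ?_⟩
  · rw [h1]
    exact add_nonneg (by positivity) (Finset.sum_nonneg fun i _ => h0 k i)
  · rw [h1]
    simp
  · obtain ⟨i, hi⟩ := har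
    refine ⟨ar i, hi, ?_⟩
    rw [h1, if_neg (by omega)]
    have := Finset.single_le_sum (f := fun j => ((Polynomial.X : Polynomial ℝ) ^ ar j).coeff (ar i))
      (fun j _ => h0 (ar i) j) (Finset.mem_univ i)
    simpa using this

section Summation

variable {ar : ι → ℕ}

/-- The weight `x ^ size φ`, cut off beyond size `N`. -/
noncomputable def truncWeight (x : ℝ≥0∞) (N : ℕ) (φ : Formula ar) : ℝ≥0∞ :=
  if φ.size ≤ N then x ^ φ.size else 0

theorem ennreal_tsum_atoms {x : ℝ} (hx : 0 < x) (hx1 : x < 1) :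
    ∑' p : ℕ × ℕ, ENNReal.ofReal x ^ (1 + indexSize p.1 + indexSize p.2) =
      ENNReal.ofReal (atomGen x) := by
  have h1 : ∀ n m : ℕ, ENNReal.ofReal x ^ (1 + indexSize n + indexSize m) =
      ENNReal.ofReal x ^ 3 * ENNReal.ofReal x ^ n * ENNReal.ofReal x ^ m := fun n m => by
    rw [← pow_add, ← pow_add]
    congr 1
    simp only [indexSize]
    ring
  have h2 : (1 : ℝ≥0∞) - ENNReal.ofReal x = ENNReal.ofReal (1 - x) := by
    rw [ENNReal.ofReal_sub _ hx.le, ENNReal.ofReal_one]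
  have h3 : 0 < 1 - x := by linarith
  rw [ENNReal.tsum_prod']
  simp only [h1, ENNReal.tsum_mul_left, ENNReal.tsum_mul_right, ENNReal.tsum_geometric, h2]
  rw [← ENNReal.ofReal_inv_of_pos h3, ← ENNReal.ofReal_pow hx.le,
    ← ENNReal.ofReal_mul (by positivity), ← ENNReal.ofReal_mul (by positivity), atomGen]
  congr 1
  field_simp

/-- The connective itself has weight one, so arguments of a formula of size at most `N + 1` have
size at most `N`. -/
theorem truncWeight_conn_le {x : ℝ≥0∞} (N : ℕ) (i : ι) (args : Fin (ar i) → Formula ar) :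
    truncWeight x (N + 1) (.conn i args) ≤ x * ∏ j, truncWeight x N (args j) := by
  by_cases h : (Formula.conn i args : Formula ar).size ≤ N + 1
  · have h1 : ∀ j, (args j).size ≤ N := fun j => by
      have := Finset.single_le_sum (f := fun j => (args j).size) (fun _ _ => Nat.zero_le _)
        (Finset.mem_univ j)
      simp only [Formula.size] at h
      omega
    rw [truncWeight, if_pos h, Formula.size, pow_add, pow_one, ← Finset.prod_pow_eq_pow_sum]
    simp only [truncWeight, h1, if_true, le_refl]
  · rw [truncWeight, if_neg h]
    exact zero_le

theorem truncWeight_le (x : ℝ≥0∞) (N : ℕ) (φ : Formula ar) :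
    truncWeight x N φ ≤ x ^ φ.size := by
  rw [truncWeight]
  split_ifs
  · exact le_rfl
  · exact zero_le

theorem norm_pow_size_le {ρ : ℝ} {z : ℂ} (hz : ‖z‖ ≤ ρ) (φ : Formula ar) : ‖z ^ φ.size‖ ≤ ρ ^ φ.size := by
  simpa using pow_le_pow_left₀ (norm_nonneg z) hz _

variable [Fintype ι]

theorem ennreal_tsum_formula (w : Formula ar → ℝ≥0∞) :
    ∑' φ, w φ = ∑' p : ℕ × ℕ, w (.mem p.1 p.2) + (∑' φ, w (.all φ) + (∑' φ, w (.ex φ) +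
      ∑ i, ∑' args, w (.conn i args))) := by
  rw [← (formulaEquiv ar).tsum_eq, ENNReal.summable.tsum_sum ENNReal.summable,
    ENNReal.summable.tsum_sum ENNReal.summable, ENNReal.summable.tsum_sum ENNReal.summable,
    ENNReal.tsum_sigma', ← tsum_fintype (L := SummationFilter.unconditional ι) fun i => ∑' args, w (.conn i args)]
  rfl

/-- The truncated sums start at zero and satisfy `S_(N+1) ≤ atomGen ρ + ρ * P S_N`; as the
right-hand side is monotone with fixed point `τ`, none exceeds `τ`. In `ℝ≥0∞` no convergence has to
be known beforehand. -/
theorem tsum_truncWeight_le {ρ τ : ℝ} (hc : IsCharacteristic (branchPoly ar) ρ τ) (N : ℕ) :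
    ∑' φ : Formula ar, truncWeight (ENNReal.ofReal ρ) N φ ≤ ENNReal.ofReal τ := by
  set x := ENNReal.ofReal ρ with hx
  have hρ := hc.pos
  have hτ := hc.pos'
  have hatom : 0 ≤ atomGen ρ := by
    have : 0 < 1 - ρ := by linarith [hc.lt_one]
    rw [atomGen]
    positivity
  induction N with
  | zero =>
    have : ∀ φ : Formula ar, truncWeight x 0 φ = 0 := fun φ => by
      cases φ <;> simp [truncWeight, Formula.size]
    simp [this]
  | succ N ih =>
    rw [ennreal_tsum_formula]
    set S := ∑' φ : Formula ar, truncWeight x N φ with hS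
    have h1 : ∑' p : ℕ × ℕ, truncWeight x (N + 1) (Formula.mem p.1 p.2 : Formula ar) ≤
        ENNReal.ofReal (atomGen ρ) := by
      rw [← ennreal_tsum_atoms hρ hc.lt_one]
      exact ENNReal.tsum_le_tsum fun p => truncWeight_le x (N + 1) (Formula.mem p.1 p.2)
    have h2 : ∀ φ : Formula ar, truncWeight x (N + 1) (.all φ) = x * truncWeight x N φ ∧
        truncWeight x (N + 1) (.ex φ) = x * truncWeight x N φ := fun φ => by
      simp only [truncWeight, Formula.size, add_comm 1, add_le_add_iff_right, mul_ite, mul_zero,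
        pow_succ', and_self]
    have h3 : ∀ i, ∑' args, truncWeight x (N + 1) (.conn i args : Formula ar) ≤
        x * S ^ ar i := fun i => by
      rw [hS, ← ennreal_tsum_prod_fin, ← ENNReal.tsum_mul_left]
      exact ENNReal.tsum_le_tsum fun args => truncWeight_conn_le N i args
    simp only [h2, ENNReal.tsum_mul_left]
    calc _ ≤ ENNReal.ofReal (atomGen ρ) + (x * ENNReal.ofReal τ + (x * ENNReal.ofReal τ +
          ∑ i, x * ENNReal.ofReal τ ^ ar i)) := by
          gcongr with i
          exact (h3 i).trans (by gcongr)
      _ = ENNReal.ofReal (atomGen ρ + (ρ * τ + (ρ * τ + ∑ i, ρ * τ ^ ar i))) := by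
          have h4 : ∀ i, 0 ≤ ρ * τ ^ ar i := fun i => by positivity
          have h5 : 0 ≤ ∑ i, ρ * τ ^ ar i := Finset.sum_nonneg fun i _ => h4 i
          have h6 : 0 ≤ ρ * τ := by positivity
          rw [ENNReal.ofReal_add hatom (by positivity), ENNReal.ofReal_add h6 (by positivity),
            ENNReal.ofReal_add h6 h5, ENNReal.ofReal_sum_of_nonneg fun i _ => h4 i]
          simp only [ENNReal.ofReal_mul hρ.le, ENNReal.ofReal_pow hτ.le, hx]
      _ = ENNReal.ofReal τ := by
          congr 1
          nth_rewrite 4 [← hc.eq]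
          simp only [branchPoly, Polynomial.eval_add, Polynomial.eval_mul, Polynomial.eval_ofNat,
            Polynomial.eval_X, Polynomial.eval_finsetSum, Polynomial.eval_pow, mul_add,
            Finset.mul_sum]
          ring

theorem sum_pow_size_le {ρ τ : ℝ} (hc : IsCharacteristic (branchPoly ar) ρ τ)
    (s : Finset (Formula ar)) : ∑ φ ∈ s, ρ ^ φ.size ≤ τ := by
  have hρ := hc.pos
  rw [← ENNReal.ofReal_le_ofReal_iff hc.pos'.le,
    ENNReal.ofReal_sum_of_nonneg fun _ _ => by positivity]
  refine le_trans ?_ (tsum_truncWeight_le hc (s.sup Formula.size))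
  refine le_trans (Finset.sum_le_sum fun φ hφ => ?_) (ENNReal.sum_le_tsum s)
  rw [truncWeight, if_pos (Finset.le_sup (f := Formula.size) hφ), ENNReal.ofReal_pow hρ.le]

theorem summable_pow_size {ρ τ : ℝ} (hc : IsCharacteristic (branchPoly ar) ρ τ) :
    Summable fun φ : Formula ar => ρ ^ φ.size :=
  summable_of_sum_le (fun _ => pow_nonneg hc.pos.le _) (sum_pow_size_le hc)

variable {ρ τ : ℝ} {z : ℂ}

theorem summable_norm_pow_size (hc : IsCharacteristic (branchPoly ar) ρ τ) (hz : ‖z‖ ≤ ρ) :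
    Summable fun φ : Formula ar => ‖z ^ φ.size‖ :=
  (summable_pow_size hc).of_nonneg_of_le (fun _ => norm_nonneg _) (norm_pow_size_le hz)

theorem norm_tsum_pow_size_le (hc : IsCharacteristic (branchPoly ar) ρ τ) (hz : ‖z‖ ≤ ρ) :
    ‖∑' φ : Formula ar, z ^ φ.size‖ ≤ τ :=
  tsum_of_norm_bounded (summable_pow_size hc).hasSum (norm_pow_size_le hz) |>.trans
    ((summable_pow_size hc).tsum_le_of_sum_le (sum_pow_size_le hc))

theorem hasSum_atoms (hz : ‖z‖ < 1) :
    HasSum (fun p : ℕ × ℕ => z ^ (1 + indexSize p.1 + indexSize p.2)) (atomGen z) := by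
  have hg := hasSum_geometric_of_norm_lt_one hz
  have hn : Summable fun n : ℕ => ‖z ^ n‖ := by
    simpa only [norm_pow] using summable_geometric_of_lt_one (norm_nonneg z) hz
  have h1 := (summable_mul_of_summable_norm hn hn).hasSum
  rw [← tsum_mul_tsum_of_summable_norm hn hn, hg.tsum_eq] at h1
  have h2 := h1.mul_left (z ^ 3)
  have h3 : z ^ 3 * ((1 - z)⁻¹ * (1 - z)⁻¹) = atomGen z := by
    rw [atomGen, div_eq_mul_inv, ← mul_inv, sq]
  rw [h3] at h2
  refine h2.congr_fun fun p => ?_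
  rw [← pow_add, ← pow_add]
  congr 1
  simp only [indexSize]
  ring

/-- Absolute convergence allows the sum to be split by the outermost constructor; a connective of
arity `k` contributes `z * S ^ k`. -/
theorem genMap_tsum_pow_size (hc : IsCharacteristic (branchPoly ar) ρ τ) (hz : ‖z‖ ≤ ρ) :
    genMap (branchPoly ar) z (∑' φ : Formula ar, z ^ φ.size) = ∑' φ : Formula ar, z ^ φ.size := by
  have hn := summable_norm_pow_size hc hz
  set S := ∑' φ : Formula ar, z ^ φ.size with hS
  have hS' : HasSum (fun φ : Formula ar => z ^ φ.size) S := hn.of_norm.hasSum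
  have hE := (formulaEquiv ar).hasSum_iff.2 hS'
  have hq : HasSum (fun φ : Formula ar => z ^ (1 + φ.size)) (z * S) := by
    simpa only [pow_add, pow_one] using hS'.mul_left z
  have hconn : ∀ i, HasSum (fun args : Fin (ar i) → Formula ar => z ^ (1 + ∑ j, (args j).size))
      (z * S ^ ar i) := fun i => by
    simpa only [pow_add, pow_one, Finset.prod_pow_eq_pow_sum] using
      (hasSum_prod_fin hn (ar i)).2.mul_left z
  set w := (fun φ : Formula ar => z ^ φ.size) ∘ formulaEquiv ar with hw
  have h1 : w ∘ Sum.inl = fun p => z ^ (1 + indexSize p.1 + indexSize p.2) := by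
    ext p; simp [w, formulaEquiv, Formula.size]
  have h2 : (w ∘ Sum.inr) ∘ Sum.inl = fun φ => z ^ (1 + φ.size) := by
    ext p; simp [w, formulaEquiv, Formula.size]
  have h3 : ((w ∘ Sum.inr) ∘ Sum.inr) ∘ Sum.inl = fun φ => z ^ (1 + φ.size) := by
    ext p; simp [w, formulaEquiv, Formula.size]
  have h4 : ((w ∘ Sum.inr) ∘ Sum.inr) ∘ Sum.inr = fun p => z ^ (1 + ∑ j, (p.2 j).size) := by
    ext p; simp [w, formulaEquiv, Formula.size]
  have hsig : HasSum (((w ∘ Sum.inr) ∘ Sum.inr) ∘ Sum.inr) (∑ i, z * S ^ ar i) := by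
    have hsum := hE.summable.comp_injective (Sum.inr_injective.comp
      (Sum.inr_injective.comp Sum.inr_injective))
    rw [← Function.comp_assoc, ← Function.comp_assoc] at hsum
    rw [h4] at hsum ⊢
    exact HasSum.sigma_of_hasSum (hasSum_fintype _) hconn hsum
  have h := HasSum.sum (h1 ▸ hasSum_atoms (hz.trans_lt hc.lt_one))
    (HasSum.sum (h2 ▸ hq) (HasSum.sum (h3 ▸ hq) hsig))
  have h5 := h.unique hE
  rw [genMap]
  simp only [branchPoly, map_add, map_mul, map_sum, map_pow, Polynomial.aeval_X, map_ofNat, mul_add,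
    Finset.mul_sum]
  linear_combination h5

theorem hasSum_genCoeff (hc : IsCharacteristic (branchPoly ar) ρ τ) (hz : ‖z‖ ≤ ρ) :
    HasSum (fun n : ℕ => genCoeff ar n * z ^ n) (∑' φ : Formula ar, z ^ φ.size) := by
  have h := (Equiv.sigmaFiberEquiv (Formula.size (ar := ar))).hasSum_iff.2
    (summable_norm_pow_size hc hz).of_norm.hasSum
  refine h.sigma fun n => ?_
  have hfin : Finite {φ : Formula ar // φ.size = n} := finite_size_eq ar n
  have := Fintype.ofFinite {φ : Formula ar // φ.size = n}
  have h1 : (fun c : {φ : Formula ar // φ.size = n} => ((fun φ : Formula ar => z ^ φ.size) ∘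
      Equiv.sigmaFiberEquiv Formula.size) ⟨n, c⟩) = fun _ => z ^ n := by
    ext c
    simp [Equiv.sigmaFiberEquiv, c.2]
  rw [h1]
  have h2 := hasSum_fintype fun _ : {φ : Formula ar // φ.size = n} => z ^ n
  have h3 : count ar n = Fintype.card {φ : Formula ar // φ.size = n} := by
    rw [count, ← Nat.card_coe_set_eq, ← Nat.card_eq_fintype_card]
    rfl
  simpa [genCoeff, h3] using h2

theorem hasSum_genCoeff_genFix (har : ∃ i, 2 ≤ ar i) (hc : IsCharacteristic (branchPoly ar) ρ τ)
    (hz : ‖z‖ < ρ) : HasSum (fun n : ℕ => genCoeff ar n * z ^ n) (genFix (branchPoly ar) z) := by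
  rw [← eq_genFix (isBranching_branchPoly har) hc hz (norm_tsum_pow_size_le hc hz.le)
    (genMap_tsum_pow_size hc hz.le)]
  exact hasSum_genCoeff hc hz.le

end Summation

end DeBruijnFormula

/-! ### Coefficient bounds and binomial coefficients. -/

namespace DeBruijnFormula

section PowerSeries

theorem hasFPowerSeriesOnBall_of_hasSum {c : ℕ → ℂ} {f : ℂ → ℂ} {ρ : ℝ} (hρ : 0 < ρ)
    (h : ∀ z : ℂ, ‖z‖ < ρ → HasSum (fun n => c n * z ^ n) (f z)) :
    HasFPowerSeriesOnBall f (FormalMultilinearSeries.ofScalars ℂ c) 0 (ENNReal.ofReal ρ) where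
  r_le := by
    refine ENNReal.le_of_forall_nnreal_lt fun r hr => ?_
    refine FormalMultilinearSeries.le_radius_of_summable _ ?_
    have hr' : ‖((r : ℝ) : ℂ)‖ < ρ := by
      rw [Complex.norm_of_nonneg r.coe_nonneg]
      have := (ENNReal.lt_ofReal_iff_toReal_lt ENNReal.coe_ne_top).1 hr
      simpa using this
    refine (h _ hr').summable.norm.congr fun n => ?_
    rw [FormalMultilinearSeries.ofScalars_norm, norm_mul, norm_pow,
      Complex.norm_of_nonneg r.coe_nonneg]
  r_pos := by simpa using hρ
  hasSum := by
    intro y hy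
    rw [Metric.mem_eball, edist_zero_right, ← ofReal_norm,
      ENNReal.ofReal_lt_ofReal_iff hρ] at hy
    simpa [FormalMultilinearSeries.ofScalars_apply_eq, mul_comm] using h y hy

theorem iteratedDeriv_eq_factorial_mul {c : ℕ → ℂ} {f : ℂ → ℂ} {ρ : ℝ} (hρ : 0 < ρ)
    (h : ∀ z : ℂ, ‖z‖ < ρ → HasSum (fun n => c n * z ^ n) (f z)) (n : ℕ) :
    iteratedDeriv n f 0 = n.factorial * c n := by
  have h1 := (hasFPowerSeriesOnBall_of_hasSum hρ h).hasFPowerSeriesAt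
  have h2 := h1.analyticAt.hasFPowerSeriesAt
  have h3 := congrFun (FormalMultilinearSeries.ofScalars_series_injective ℂ ℂ
    (h2.eq_formalMultilinearSeries h1)) n
  beta_reduce at h3
  rw [← h3, mul_div_cancel₀]
  exact_mod_cast n.factorial_ne_zero

/-- Coefficients of an analytic function with bounded second derivative in the unit disk. -/
theorem norm_coeff_mul_le_of_deriv_deriv_bounded {c : ℕ → ℂ} {f : ℂ → ℂ} {M : ℝ}
    (h : ∀ z : ℂ, ‖z‖ < 1 → HasSum (fun n => c n * z ^ n) (f z))
    (hM : ∀ z : ℂ, ‖z‖ < 1 → ‖deriv (deriv f) z‖ ≤ M) (n : ℕ) :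
    ‖c (n + 2)‖ * ((n + 2) * (n + 1)) ≤ M := by
  have hf : AnalyticOnNhd ℂ f (Metric.ball 0 1) := by
    have := (hasFPowerSeriesOnBall_of_hasSum one_pos h).analyticOnNhd
    rwa [Metric.eball_ofReal] at this
  have hd : DifferentiableOn ℂ (deriv (deriv f)) (Metric.ball 0 1) :=
    hf.deriv.deriv.differentiableOn
  -- Cauchy's estimate for the second derivative on a circle of radius `R < 1`; then `R` tends to
  -- one.
  have hcauchy : ∀ R : ℝ, 0 < R → R < 1 →
      ‖iteratedDeriv n (deriv (deriv f)) 0‖ * R ^ n ≤ n.factorial * M := by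
    intro R hR hR1
    rw [← le_div_iff₀ (pow_pos hR n)]
    refine Complex.norm_iteratedDeriv_le_of_forall_mem_sphere_norm_le n hR ?_ fun z hz => hM z ?_
    · refine (hd.mono ?_).diffContOnCl
      rw [closure_ball _ hR.ne']
      exact Metric.closedBall_subset_ball hR1
    · rw [mem_sphere_zero_iff_norm] at hz
      linarith
  have hlim : ‖iteratedDeriv n (deriv (deriv f)) 0‖ ≤ n.factorial * M := by
    have ht : Tendsto (fun R : ℝ => ‖iteratedDeriv n (deriv (deriv f)) 0‖ * R ^ n) (𝓝[<] 1)
        (𝓝 (‖iteratedDeriv n (deriv (deriv f)) 0‖ * 1 ^ n)) :=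
      ((continuous_const.mul (continuous_pow n)).tendsto 1).mono_left nhdsWithin_le_nhds
    rw [one_pow, mul_one] at ht
    refine le_of_tendsto ht ?_
    filter_upwards [nhdsWithin_le_nhds (lt_mem_nhds one_pos), self_mem_nhdsWithin] with R h0 h1
      using hcauchy R h0 h1
  rw [← iteratedDeriv_succ', ← iteratedDeriv_succ', iteratedDeriv_eq_factorial_mul one_pos h,
    norm_mul, Complex.norm_natCast, Nat.factorial_succ, Nat.factorial_succ] at hlim
  push_cast at hlim
  have hfac : (0 : ℝ) < n.factorial := by exact_mod_cast n.factorial_pos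
  refine le_of_mul_le_mul_left ?_ hfac
  calc _ = (n + 1 + 1) * ((n + 1) * (n.factorial : ℝ)) * ‖c (n + 2)‖ := by ring
    _ ≤ _ := hlim

end PowerSeries

section Binomial

theorem factorial_mul_choose (a : ℝ) (n : ℕ) :
    (n.factorial : ℝ) * Ring.choose a n = ∏ j ∈ Finset.range n, (a - j) := by
  rw [← nsmul_eq_mul, ← Ring.descPochhammer_eq_factorial_smul_choose]
  induction n with
  | zero => simp
  | succ n ih =>
    rw [Finset.prod_range_succ, ← ih]
    simp [descPochhammer_succ_right, Polynomial.smeval_mul, Polynomial.smeval_natCast]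

/-- The coefficients of `(1 - z) ^ a`. -/
noncomputable def binomCoeff (a : ℝ) (n : ℕ) : ℝ := (-1) ^ n * Ring.choose a n

/-- Up to the factor `n / (n - a)`, the sequence is the reciprocal of Euler's product `Real.GammaSeq
(-a) n`. The hypothesis keeps `-a` off the poles of the Gamma function. -/
theorem tendsto_binomCoeff {a : ℝ} (ha : ∀ m : ℕ, a ≠ m) :
    Tendsto (fun n : ℕ => binomCoeff a n * (n : ℝ) ^ (a + 1)) atTop (𝓝 (Real.Gamma (-a))⁻¹) := by
  have hΓ : Real.Gamma (-a) ≠ 0 := Real.Gamma_ne_zero fun m h => ha m (by linarith)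
  have h1 := (Real.GammaSeq_tendsto_Gamma (-a)).inv₀ hΓ
  have h2 : Tendsto (fun n : ℕ => (n : ℝ) / (n - a)) atTop (𝓝 1) := by
    have := tendsto_natCast_div_add_atTop (𝕜 := ℝ) (-a)
    simpa [sub_eq_add_neg] using this
  have h3 := h2.mul h1
  rw [one_mul] at h3
  refine h3.congr' ?_
  filter_upwards [eventually_gt_atTop 0] with n hn
  have hn' : (0 : ℝ) < n := by exact_mod_cast hn
  have hna : (n : ℝ) - a ≠ 0 := sub_ne_zero.2 (ha n).symm
  have hprod : ∏ j ∈ Finset.range (n + 1), (-a + j) =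
      (n.factorial * binomCoeff a n) * (n - a) := by
    rw [Finset.prod_range_succ, binomCoeff, mul_left_comm, factorial_mul_choose]
    have : ∀ j ∈ Finset.range n, -a + (j : ℝ) = (-1) * (a - j) := fun j _ => by ring
    rw [Finset.prod_congr rfl this, Finset.prod_mul_distrib]
    simp only [Finset.prod_const, Finset.card_range]
    ring
  have hfac : (n.factorial : ℝ) ≠ 0 := by exact_mod_cast n.factorial_ne_zero
  have hpow : (n : ℝ) ^ (-a) * (n : ℝ) ^ (a + 1) = n := by
    rw [← Real.rpow_add hn']
    simp
  have hpow0 : (n : ℝ) ^ (-a) ≠ 0 := (Real.rpow_pos_of_pos hn' _).ne'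
  rw [Real.GammaSeq, hprod, inv_div]
  field_simp
  linear_combination (-binomCoeff a n) * hpow

theorem hasSum_binomCoeff (a : ℝ) {z : ℂ} (hz : ‖z‖ < 1) :
    HasSum (fun n : ℕ => (binomCoeff a n : ℂ) * z ^ n) ((1 - z) ^ (a : ℂ)) := by
  have h := (Complex.one_add_cpow_hasFPowerSeriesOnBall_zero (a := (a : ℂ))).hasSum (y := -z)
    (by rw [← ENNReal.ofReal_one, Metric.eball_ofReal]; simpa using hz)
  rw [zero_add, ← sub_eq_add_neg] at h
  refine h.congr_fun fun n => ?_
  rw [binomialSeries_apply, binomCoeff, List.ofFn_const, List.prod_replicate, neg_pow]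
  push_cast [Complex.ofReal_choose]
  rw [smul_eq_mul]
  ring

end Binomial

end DeBruijnFormula

/-! ### Darboux's method. -/

namespace DeBruijnFormula

theorem analyticAt_dslope {f : ℂ → ℂ} {x : ℂ} (hf : AnalyticAt ℂ f x) :
    AnalyticAt ℂ (dslope f x) x := by
  obtain ⟨p, hp⟩ := hf
  exact ⟨_, hp.has_fpower_series_dslope_fslope⟩

theorem eq_add_mul_dslope_zero (f : ℂ → ℂ) (s : ℂ) : f s = f 0 + s * dslope f 0 s := by
  have := sub_smul_dslope f 0 s
  rw [smul_eq_mul, sub_zero] at this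
  rw [this]
  ring

/-- The fourth order Taylor expansion of an analytic function, with analytic remainder. -/
theorem exists_fourth_order_taylor {f : ℂ → ℂ} (hf : AnalyticAt ℂ f 0) :
    ∃ (A B β : ℂ) (χ : ℂ → ℂ), AnalyticAt ℂ χ 0 ∧
      ∀ s, f s = A + deriv f 0 * s + B * s ^ 2 + β * s ^ 3 + s ^ 4 * χ s := by
  set f₁ := dslope f 0 with hf₁
  set f₂ := dslope f₁ 0 with hf₂
  set f₃ := dslope f₂ 0 with hf₃
  refine ⟨f 0, f₂ 0, f₃ 0, dslope f₃ 0, analyticAt_dslope (analyticAt_dslope (analyticAt_dslope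
    (analyticAt_dslope hf))), fun s => ?_⟩
  rw [← dslope_same, ← hf₁, eq_add_mul_dslope_zero f s, ← hf₁, eq_add_mul_dslope_zero f₁ s, ← hf₂,
    eq_add_mul_dslope_zero f₂ s, ← hf₃, eq_add_mul_dslope_zero f₃ s]
  ring

/-- A function on a subset of a compact set is bounded if it is bounded near each point. -/
theorem exists_norm_le_of_locally_bounded {f : ℂ → ℂ} {U K : Set ℂ} (hK : IsCompact K)
    (hUK : U ⊆ K) (h : ∀ w ∈ K, ∃ M : ℝ, ∀ᶠ z in 𝓝[U] w, ‖f z‖ ≤ M) :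
    ∃ M : ℝ, ∀ z ∈ U, ‖f z‖ ≤ M := by
  have key : ∃ M : ℝ, ∀ z ∈ K, z ∈ U → ‖f z‖ ≤ M := by
    refine hK.induction_on (p := fun s => ∃ M : ℝ, ∀ z ∈ s, z ∈ U → ‖f z‖ ≤ M) ⟨0, by simp⟩
      (fun s t hst ⟨M, hM⟩ => ⟨M, fun z hz => hM z (hst hz)⟩) ?_ ?_
    · rintro s t ⟨M, hM⟩ ⟨N, hN⟩
      refine ⟨max M N, fun z hz hzU => ?_⟩
      rcases hz with hz | hz
      · exact (hM z hz hzU).trans (le_max_left _ _)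
      · exact (hN z hz hzU).trans (le_max_right _ _)
    · intro w hw
      obtain ⟨M, hM⟩ := h w hw
      exact ⟨_, mem_nhdsWithin_of_mem_nhds (eventually_nhdsWithin_iff.1 hM), M, fun z hz => hz⟩
  obtain ⟨M, hM⟩ := key
  exact ⟨M, fun z hz => hM z (hUK hz) hz⟩

theorem deriv_deriv_eq_of_eventuallyEq_nhdsWithin {f g : ℂ → ℂ} {U : Set ℂ} {w : ℂ}
    (hU : IsOpen U) (h : f =ᶠ[𝓝[U] w] g) :
    deriv (deriv f) =ᶠ[𝓝[U] w] deriv (deriv g) := by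
  filter_upwards [eventually_eventually_nhdsWithin.2 h, self_mem_nhdsWithin] with z hz hzU
  rw [hU.nhdsWithin_eq hzU] at hz
  have hz : f =ᶠ[𝓝 z] g := hz
  exact hz.deriv.deriv_eq

theorem exists_norm_le_of_analyticAt {f : ℂ → ℂ} {w : ℂ} (hf : AnalyticAt ℂ f w) :
    ∃ M : ℝ, ∀ᶠ z in 𝓝 w, ‖f z‖ ≤ M :=
  ⟨‖f w‖ + 1, (hf.continuousAt.norm.eventually_lt continuousAt_const (lt_add_one _)).mono
    fun _ => le_of_lt⟩

section UnitDisk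

variable {z : ℂ}

theorem not_one_le_re_of_norm_lt_one (hz : ‖z‖ < 1) : ¬ (1 ≤ z.re ∧ z.im = 0) := fun h => by
  have := Complex.re_le_norm z
  linarith [h.1]

theorem singRoot_one_ne_zero (hz : ‖z‖ < 1) : singRoot 1 z ≠ 0 := by
  intro h
  have := singRoot_sq 1 z
  rw [h] at this
  refine one_sub_ne_zero_of_norm_lt_one hz ?_
  simpa using this.symm

theorem hasDerivAt_singRoot_one (hz : ‖z‖ < 1) :
    HasDerivAt (singRoot 1) (-1 / (2 * singRoot 1 z)) z := by
  have hd := (analyticAt_singRoot one_pos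
    (not_one_le_re_of_norm_lt_one hz)).differentiableAt.hasDerivAt
  have h1 := hd.fun_pow 2
  have h2 : (fun w => singRoot 1 w ^ 2) = fun w => 1 - w := by
    ext w
    simpa using singRoot_sq 1 w
  rw [h2] at h1
  have h3 := h1.unique ((hasDerivAt_id z).const_sub 1)
  have h0 := singRoot_one_ne_zero hz
  have h4 : deriv (singRoot 1) z = -1 / (2 * singRoot 1 z) := by
    rw [eq_div_iff (by simpa using h0)]
    push_cast at h3
    linear_combination h3
  rwa [h4] at hd

/-- The second derivative of a function `A + B s ^ 2 + s ^ 4 χ` of `s = √(1 - z)` stays bounded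
at `z = 1`. -/
theorem exists_norm_deriv_deriv_comp_singRoot_le {χ : ℂ → ℂ} (hχ : AnalyticAt ℂ χ 0) (A B : ℂ) :
    ∃ M : ℝ, ∀ᶠ z in 𝓝[Metric.ball 0 1] (1 : ℂ), ‖deriv (deriv fun z => A + B * singRoot 1 z ^ 2 +
      singRoot 1 z ^ 4 * χ (singRoot 1 z)) z‖ ≤ M := by
  set F : ℂ → ℂ := fun z => A + B * singRoot 1 z ^ 2 + singRoot 1 z ^ 4 * χ (singRoot 1 z) with hF
  -- `η` and `θ` are the first two derivatives of `F` in terms of `s`, computed with `ds/dz = -1 /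
  -- (2 s)`. The negative powers of `s` cancel, since there is no odd term below `s ^ 5`.
  set η : ℂ → ℂ := fun s => -(B + 2 * s ^ 2 * χ s + s ^ 3 * deriv χ s / 2) with hη
  set θ : ℂ → ℂ := fun s => 2 * χ s + 7 / 4 * s * deriv χ s + s ^ 2 * deriv (deriv χ) s / 4 with hθ
  have htend : Tendsto (singRoot 1) (𝓝 (1 : ℂ)) (𝓝 0) := by
    simpa using tendsto_singRoot one_pos
  have hev : ∀ᶠ z in 𝓝[Metric.ball 0 1] (1 : ℂ), ‖z‖ < 1 ∧ AnalyticAt ℂ χ (singRoot 1 z) := by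
    filter_upwards [nhdsWithin_le_nhds (htend.eventually hχ.eventually_analyticAt),
      self_mem_nhdsWithin] with z h1 h2 using ⟨by simpa using h2, h1⟩
  have hd1 : ∀ᶠ z in 𝓝[Metric.ball 0 1] (1 : ℂ), deriv F z = η (singRoot 1 z) := by
    filter_upwards [hev] with z ⟨hz, hχz⟩
    have hS := hasDerivAt_singRoot_one hz
    have h0 := singRoot_one_ne_zero hz
    have hX : HasDerivAt (fun z => χ (singRoot 1 z)) _ z :=
      hχz.differentiableAt.hasDerivAt.comp z hS
    rw [(((((hS.fun_pow 2).const_mul B).const_add A)).fun_add ((hS.fun_pow 4).fun_mul hX)).deriv]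
    simp only [hη]
    push_cast
    field_simp
    ring
  have hd2 : ∀ᶠ z in 𝓝[Metric.ball 0 1] (1 : ℂ), deriv (deriv F) z = θ (singRoot 1 z) := by
    filter_upwards [hev, eventually_eventually_nhdsWithin.2 hd1] with z ⟨hz, hχz⟩ hev
    rw [Metric.isOpen_ball.nhdsWithin_eq (by simpa using hz)] at hev
    have hev : deriv F =ᶠ[𝓝 z] fun z => η (singRoot 1 z) := hev
    rw [hev.deriv_eq]
    have hS := hasDerivAt_singRoot_one hz
    have h0 := singRoot_one_ne_zero hz
    have hX : HasDerivAt (fun z => χ (singRoot 1 z)) _ z :=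
      hχz.differentiableAt.hasDerivAt.comp z hS
    have hX' : HasDerivAt (fun z => deriv χ (singRoot 1 z)) _ z :=
      hχz.deriv.differentiableAt.hasDerivAt.comp z hS
    have := (((((hS.fun_pow 2).const_mul 2).fun_mul hX).const_add B).fun_add
      (((hS.fun_pow 3).fun_mul hX').div_const 2)).fun_neg
    rw [this.deriv]
    simp only [hθ]
    push_cast
    field_simp
    ring
  have hθa : AnalyticAt ℂ θ 0 := by
    have h1 := hχ.deriv
    have h2 := hχ.deriv.deriv
    fun_prop
  obtain ⟨M, hM⟩ := exists_norm_le_of_analyticAt hθa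
  refine ⟨M, ?_⟩
  filter_upwards [hd2, nhdsWithin_le_nhds (htend.eventually hM)] with z h1 h2
  rwa [h1]

/-- Darboux's method for a square root singularity at `1`. -/
theorem tendsto_coeff_of_sqrt_singularity {c : ℕ → ℂ} {f ψ : ℂ → ℂ}
    (h : ∀ z : ℂ, ‖z‖ < 1 → HasSum (fun n => c n * z ^ n) (f z))
    (hreg : ∀ w : ℂ, ‖w‖ = 1 → w ≠ 1 →
      ∃ g, AnalyticAt ℂ g w ∧ ∀ᶠ z in 𝓝[Metric.ball 0 1] w, f z = g z)
    (hψ : AnalyticAt ℂ ψ 0) (hsing : ∀ᶠ z in 𝓝[Metric.ball 0 1] (1 : ℂ), f z = ψ (singRoot 1 z)) :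
    Tendsto (fun n : ℕ => c n * ((n : ℝ) ^ (3 / 2 : ℝ) : ℝ)) atTop
      (𝓝 (deriv ψ 0 * ((Real.Gamma (-(1 / 2)))⁻¹ : ℝ))) := by
  obtain ⟨A, B, β, χ, hχ, hexp⟩ := exists_fourth_order_taylor hψ
  set α := deriv ψ 0 with hα
  -- The terms of degree one and three in `s` are subtracted; they are multiples of `(1 - z) ^
  -- (1/2)` and `(1 - z) ^ (3/2)`, whose coefficients are known.
  set r : ℂ → ℂ := fun z => f z - (α + β * (1 - z)) * singRoot 1 z with hr
  set d : ℕ → ℂ := fun n => c n - (α * binomCoeff (1 / 2) n + β * binomCoeff (3 / 2) n) with hd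
  have hrd : ∀ z : ℂ, ‖z‖ < 1 → HasSum (fun n => d n * z ^ n) (r z) := by
    intro z hz
    have h1 := hasSum_binomCoeff (1 / 2) hz
    have h3 := hasSum_binomCoeff (3 / 2) hz
    have e1 : (1 - z) ^ ((1 / 2 : ℝ) : ℂ) = singRoot 1 z := by
      simp [singRoot]
    have e3 : (1 - z) ^ ((3 / 2 : ℝ) : ℂ) = (1 - z) * singRoot 1 z := by
      have h32 : ((3 / 2 : ℝ) : ℂ) = 1 + ((1 / 2 : ℝ) : ℂ) := by push_cast; norm_num
      rw [h32, Complex.cpow_add _ _ (one_sub_ne_zero_of_norm_lt_one hz), Complex.cpow_one, e1]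
    rw [e1] at h1
    rw [e3] at h3
    have e : r z = f z - (α * singRoot 1 z + β * ((1 - z) * singRoot 1 z)) := by
      simp only [hr]; ring
    rw [e]
    refine ((h z hz).sub ((h1.mul_left α).add (h3.mul_left β))).congr_fun fun n => ?_
    simp only [hd]
    ring
  have hbound : ∃ M : ℝ, ∀ z ∈ Metric.ball (0 : ℂ) 1, ‖deriv (deriv r) z‖ ≤ M := by
    refine exists_norm_le_of_locally_bounded (isCompact_closedBall (0 : ℂ) 1)
      Metric.ball_subset_closedBall fun w hw => ?_
    by_cases hw1 : w = 1
    · subst hw1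
      obtain ⟨M, hM⟩ := exists_norm_deriv_deriv_comp_singRoot_le hχ A B
      refine ⟨M, ?_⟩
      have hreq : r =ᶠ[𝓝[Metric.ball 0 1] 1] fun z => A + B * singRoot 1 z ^ 2 +
          singRoot 1 z ^ 4 * χ (singRoot 1 z) := by
        filter_upwards [hsing] with z hz
        have hsq : 1 - z = singRoot 1 z ^ 2 := by simpa using (singRoot_sq 1 z).symm
        simp only [hr]
        rw [hz, hexp, hsq]
        ring
      filter_upwards [hM, deriv_deriv_eq_of_eventuallyEq_nhdsWithin Metric.isOpen_ball hreq]
        with z h1 h2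
      rwa [h2]
    · have hS : AnalyticAt ℂ (singRoot 1) w := by
        refine analyticAt_singRoot one_pos fun hslit => hw1 ?_
        have h1 := Complex.re_le_norm w
        have h2 : ‖w‖ ≤ 1 := by simpa using hw
        exact Complex.ext (by simp only [Complex.one_re]; linarith [hslit.1]) (by simpa using hslit.2)
      obtain ⟨g, hg, hfg⟩ : ∃ g, AnalyticAt ℂ g w ∧ ∀ᶠ z in 𝓝[Metric.ball 0 1] w, f z = g z := by
        rcases (show ‖w‖ ≤ 1 by simpa using hw).lt_or_eq with hlt | heq
        · refine ⟨f, ?_, Eventually.of_forall fun _ => rfl⟩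
          refine (hasFPowerSeriesOnBall_of_hasSum one_pos h).analyticOnNhd w ?_
          rw [Metric.eball_ofReal]
          simpa using hlt
        · exact hreg w heq hw1
      have hG : AnalyticAt ℂ (fun z => g z - (α + β * (1 - z)) * singRoot 1 z) w := by fun_prop
      obtain ⟨M, hM⟩ := exists_norm_le_of_analyticAt hG.deriv.deriv
      refine ⟨M, ?_⟩
      have hreq : r =ᶠ[𝓝[Metric.ball 0 1] w] fun z => g z - (α + β * (1 - z)) * singRoot 1 z := by
        filter_upwards [hfg] with z hz
        simp only [hr, hz]
      filter_upwards [nhdsWithin_le_nhds hM,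
        deriv_deriv_eq_of_eventuallyEq_nhdsWithin Metric.isOpen_ball hreq] with z h1 h2
      rwa [h2]
  obtain ⟨M, hM⟩ := hbound
  have hdn := norm_coeff_mul_le_of_deriv_deriv_bounded hrd fun z hz => hM z (by simpa using hz)
  have hd0 : Tendsto (fun n : ℕ => d n * ((n : ℝ) ^ (3 / 2 : ℝ) : ℝ)) atTop (𝓝 0) := by
    -- The factor two comes from `n ^ 2 ≤ 2 n (n - 1)` for `n ≥ 2`.
    have hlim : Tendsto (fun n : ℕ => 2 * M * (n : ℝ) ^ (-(1 / 2) : ℝ)) atTop (𝓝 0) := by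
      have := (tendsto_rpow_neg_atTop (show (0 : ℝ) < 1 / 2 by norm_num)).comp
        tendsto_natCast_atTop_atTop
      simpa using this.const_mul (2 * M)
    refine squeeze_zero_norm' ?_ hlim
    filter_upwards [eventually_ge_atTop 2] with n hn
    obtain ⟨k, rfl⟩ := Nat.exists_eq_add_of_le' hn
    have hk : (0 : ℝ) < ((k + 2 : ℕ) : ℝ) := by positivity
    rw [norm_mul, Complex.norm_real, Real.norm_of_nonneg (Real.rpow_nonneg hk.le _)]
    have e1 : ((k + 2 : ℕ) : ℝ) ^ (3 / 2 : ℝ) =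
        ((k + 2 : ℕ) : ℝ) ^ 2 * ((k + 2 : ℕ) : ℝ) ^ (-(1 / 2) : ℝ) := by
      rw [← Real.rpow_natCast, ← Real.rpow_add hk]
      norm_num
    rw [e1, ← mul_assoc]
    refine mul_le_mul_of_nonneg_right ?_ (Real.rpow_nonneg hk.le _)
    refine le_trans ?_ (mul_le_mul_of_nonneg_left (hdn k) zero_le_two)
    rw [mul_left_comm]
    refine mul_le_mul_of_nonneg_left ?_ (norm_nonneg _)
    push_cast
    nlinarith [(Nat.cast_nonneg k : (0 : ℝ) ≤ k)]
  have hhalf : Tendsto (fun n : ℕ => binomCoeff (1 / 2) n * (n : ℝ) ^ (3 / 2 : ℝ)) atTop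
      (𝓝 (Real.Gamma (-(1 / 2)))⁻¹) := by
    have := tendsto_binomCoeff (a := 1 / 2) fun m hm => by
      have h2 : ((1 : ℕ) : ℝ) = ((2 * m : ℕ) : ℝ) := by push_cast; linarith
      have := Nat.cast_injective h2
      omega
    norm_num at this ⊢
    exact this
  have hthree : Tendsto (fun n : ℕ => binomCoeff (3 / 2) n * (n : ℝ) ^ (3 / 2 : ℝ)) atTop
      (𝓝 0) := by
    have h1 := tendsto_binomCoeff (a := 3 / 2) fun m hm => by
      have h2 : ((3 : ℕ) : ℝ) = ((2 * m : ℕ) : ℝ) := by push_cast; linarith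
      have := Nat.cast_injective h2
      omega
    have h2 := (tendsto_rpow_neg_atTop (show (0 : ℝ) < 1 by norm_num)).comp
      (tendsto_natCast_atTop_atTop (R := ℝ))
    have h3 := h1.mul h2
    rw [mul_zero] at h3
    refine h3.congr' ?_
    filter_upwards [eventually_gt_atTop 0] with n hn
    have hn' : (0 : ℝ) < n := by exact_mod_cast hn
    rw [Function.comp_apply, mul_assoc, ← Real.rpow_add hn']
    norm_num
  have hsum := (hd0.add ((Complex.continuous_ofReal.tendsto _).comp hhalf |>.const_mul α)).add
    ((Complex.continuous_ofReal.tendsto _).comp hthree |>.const_mul β)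
  simp only [zero_add, Complex.ofReal_zero, mul_zero, add_zero] at hsum
  refine hsum.congr fun n => ?_
  simp only [hd, Function.comp_apply]
  push_cast
  ring

end UnitDisk

end DeBruijnFormula

/-! ### Transfer to the dominant singularity at `ρ`. -/

namespace DeBruijnFormula

theorem Gamma_neg_half_neg : Real.Gamma (-(1 / 2)) < 0 := by
  have h1 := Real.Gamma_add_one (s := -(1 / 2)) (by norm_num)
  have h2 : 0 < Real.Gamma (-(1 / 2) + 1) := Real.Gamma_pos_of_pos (by norm_num)
  linarith

theorem isBigO_sub_linear {ψ : ℂ → ℂ} (hψ : AnalyticAt ℂ ψ 0) :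
    (fun s => ψ s - (ψ 0 + deriv ψ 0 * s)) =O[𝓝 0] fun s => ‖s‖ ^ 2 := by
  have h := analyticAt_dslope (analyticAt_dslope hψ)
  obtain ⟨M, hM⟩ := exists_norm_le_of_analyticAt h
  refine IsBigO.of_bound M ?_
  filter_upwards [hM] with s hs
  have e : ψ s - (ψ 0 + deriv ψ 0 * s) = s ^ 2 * dslope (dslope ψ 0) 0 s := by
    rw [← dslope_same, eq_add_mul_dslope_zero ψ s, eq_add_mul_dslope_zero (dslope ψ 0) s]
    ring
  rw [e, norm_mul, norm_pow, Real.norm_of_nonneg (by positivity), mul_comm]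
  gcongr

theorem exists_coeff_eventually_hasSum {ψ : ℂ → ℂ} (hψ : AnalyticAt ℂ ψ 0) :
    ∃ c : ℕ → ℂ, c 0 = ψ 0 ∧ c 1 = deriv ψ 0 ∧ ∀ᶠ s in 𝓝 0, HasSum (fun k => c k * s ^ k) (ψ s) := by
  refine ⟨fun k => iteratedDeriv k ψ 0 / k.factorial, by simp, by simp, ?_⟩
  filter_upwards [hasFPowerSeriesAt_iff.1 hψ.hasFPowerSeriesAt] with s hs
  simpa [mul_comm] using hs

section Singularity

variable {c : ℕ → ℂ} {ρ : ℝ} {f ψ : ℂ → ℂ}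

/-- A square root singularity is a singularity. -/
theorem isSingularPoint_of_comp_singRoot (hρ : 0 < ρ) (hψ : AnalyticAt ℂ ψ 0)
    (hψ1 : deriv ψ 0 ≠ 0)
    (h : ∀ᶠ z in 𝓝[Metric.ball 0 ρ] (ρ : ℂ), powerSum c z = ψ (singRoot ρ z)) :
    IsSingularPoint c ρ := by
  rintro ⟨G, hG, hGc⟩
  rw [Complex.norm_of_nonneg hρ.le] at hGc
  -- If `G` continued the sum analytically to `ρ`, then `G (ρ (1 - s ^ 2))` would have derivative
  -- zero at `s = 0`. It agrees with `ψ` for small `s > 0`, hence near zero, which contradicts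
  -- `deriv ψ 0 ≠ 0`.
  set m : ℂ → ℂ := fun s => ρ * (1 - s ^ 2) with hm
  have hm0 : m 0 = ρ := by simp [hm]
  have hGm : AnalyticAt ℂ (fun s => G (m s)) 0 :=
    AnalyticAt.comp (g := G) (f := m) (by rwa [hm0]) (by fun_prop)
  have hmd : HasDerivAt m 0 0 := by
    refine ((((hasDerivAt_id (0 : ℂ)).fun_pow 2).const_sub 1).const_mul (ρ : ℂ)).congr_deriv ?_
    simp
  have hd : deriv (fun s => G (m s)) 0 = 0 := by
    have hG' : HasDerivAt G (deriv G ρ) (m 0) := by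
      rw [hm0]; exact hG.differentiableAt.hasDerivAt
    exact ((hG'.comp (0 : ℂ) hmd).congr_deriv (mul_zero _)).deriv
  have hof : Tendsto (fun s : ℝ => (s : ℂ)) (𝓝[>] 0) (𝓝[≠] 0) := by
    refine tendsto_nhdsWithin_iff.2 ⟨?_, ?_⟩
    · exact (Complex.continuous_ofReal.tendsto' 0 0 (by simp)).mono_left nhdsWithin_le_nhds
    · filter_upwards [self_mem_nhdsWithin] with s hs
      have hs : 0 < s := hs
      simpa using hs.ne'
  have hmt : Tendsto (fun s : ℝ => m s) (𝓝[>] 0) (𝓝[Metric.ball 0 ρ] (ρ : ℂ)) := by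
    refine tendsto_nhdsWithin_iff.2 ⟨?_, ?_⟩
    · have := hmd.continuousAt.tendsto.comp (hof.mono_right nhdsWithin_le_nhds)
      rwa [hm0] at this
    · filter_upwards [self_mem_nhdsWithin, nhdsWithin_le_nhds (gt_mem_nhds one_pos)] with s hs hs1
      have hs : 0 < s := hs
      have e : m s = ((ρ * (1 - s ^ 2) : ℝ) : ℂ) := by simp [hm]
      have h2 : s ^ 2 < 1 := by nlinarith
      rw [mem_ball_zero_iff, e, Complex.norm_of_nonneg (mul_nonneg hρ.le (by linarith))]
      nlinarith [mul_pos hρ (pow_pos hs 2)]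
  have heq : ∀ᶠ s : ℝ in 𝓝[>] 0, G (m s) = ψ s := by
    filter_upwards [hmt.eventually h, hmt.eventually hGc, self_mem_nhdsWithin] with s h1 h2 hs
    have hs : 0 < s := hs
    rw [h2, h1, hm, singRoot_mul_one_sub_sq hρ hs.le]
  have hfreq : ∃ᶠ s in 𝓝[≠] (0 : ℂ), G (m s) = ψ s := hof.frequently heq.frequently
  have hev := (hGm.frequently_eq_iff_eventually_eq hψ).1 hfreq
  have hev : (fun s => G (m s)) =ᶠ[𝓝 0] ψ := hev
  exact hψ1 (by rw [← hev.deriv_eq, hd])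

theorem isUniqueDominantSingularity_of_singRoot (hρ : 0 < ρ)
    (hf : ∀ z : ℂ, ‖z‖ < ρ → HasSum (fun n => c n * z ^ n) (f z))
    (hreg : ∀ w : ℂ, ‖w‖ = ρ → w ≠ ρ → AnalyticAt ℂ f w) (hψ : AnalyticAt ℂ ψ 0)
    (hψ1 : deriv ψ 0 ≠ 0)
    (h : ∀ᶠ z in 𝓝[Metric.ball 0 ρ] (ρ : ℂ), f z = ψ (singRoot ρ z)) :
    IsUniqueDominantSingularity c ρ := by
  have hnorm : ‖(ρ : ℂ)‖ = ρ := Complex.norm_of_nonneg hρ.le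
  have hps : ∀ z ∈ Metric.ball (0 : ℂ) ρ, f z = powerSum c z := fun z hz =>
    (hf z (by simpa using hz)).tsum_eq.symm
  have hsing : IsSingularPoint c ρ := by
    refine isSingularPoint_of_comp_singRoot hρ hψ hψ1 ?_
    filter_upwards [h, self_mem_nhdsWithin] with z hz hzb
    rw [← hps z hzb, hz]
  refine ⟨?_, fun w hw => ⟨fun hws => ?_, fun hws => hws ▸ hsing⟩⟩
  · rw [hnorm]
    refine le_antisymm ?_ (hasFPowerSeriesOnBall_of_hasSum hρ hf).r_le
    -- A larger radius would make the sum of the series itself analytic at `ρ`.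
    by_contra! hlt
    refine hsing ⟨(FormalMultilinearSeries.ofScalars ℂ c).sum, ?_, Eventually.of_forall fun z => ?_⟩
    · refine ((FormalMultilinearSeries.ofScalars ℂ c).hasFPowerSeriesOnBall
        (pos_of_gt hlt)).analyticOnNhd _ ?_
      rw [Metric.mem_eball, edist_zero_right, ← ofReal_norm, hnorm]
      exact hlt
    · rw [powerSum, FormalMultilinearSeries.sum]
      exact tsum_congr fun n => by simp [mul_comm]
  · rw [hnorm] at hw
    by_contra hne
    refine hws ⟨f, hreg w hw hne, ?_⟩
    rw [hw]
    filter_upwards [self_mem_nhdsWithin] with z hz using hps z hz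

theorem singRoot_mul (hρ : 0 < ρ) (z : ℂ) : singRoot ρ (ρ * z) = singRoot 1 z := by
  have hρC : (ρ : ℂ) ≠ 0 := by exact_mod_cast hρ.ne'
  rw [singRoot, singRoot, mul_div_cancel_left₀ _ hρC, Complex.ofReal_one, div_one]

theorem isEquivalent_of_singRoot {a : ℕ → ℕ} {b : ℝ} (hρ : 0 < ρ) (hb : 0 < b)
    (hf : ∀ z : ℂ, ‖z‖ < ρ → HasSum (fun n => (a n : ℂ) * z ^ n) (f z))
    (hreg : ∀ w : ℂ, ‖w‖ = ρ → w ≠ ρ → AnalyticAt ℂ f w) (hψ : AnalyticAt ℂ ψ 0)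
    (hψ1 : deriv ψ 0 = -b)
    (h : ∀ᶠ z in 𝓝[Metric.ball 0 ρ] (ρ : ℂ), f z = ψ (singRoot ρ z)) :
    ∃ C : ℝ, 0 < C ∧ (fun n : ℕ => (a n : ℝ)) ~[atTop]
      fun n : ℕ => C * ρ⁻¹ ^ n * (n : ℝ) ^ (-(3 / 2) : ℝ) := by
  have hρC : (ρ : ℂ) ≠ 0 := by exact_mod_cast hρ.ne'
  have hnorm : ∀ z : ℂ, ‖(ρ : ℂ) * z‖ = ρ * ‖z‖ := fun z => by
    rw [norm_mul, Complex.norm_of_nonneg hρ.le]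
  have hmul : ∀ z : ℂ, ‖z‖ < 1 → ‖(ρ : ℂ) * z‖ < ρ := fun z hz => by
    rw [hnorm]
    nlinarith
  -- Rescaling by `z ↦ ρ z` moves the singularity to one and turns the coefficients into `a n * ρ ^
  -- n`.
  have key := tendsto_coeff_of_sqrt_singularity (c := fun n => (a n : ℂ) * ρ ^ n)
    (f := fun z => f (ρ * z)) (ψ := ψ) (fun z hz => ?_) (fun w hw hw1 => ?_) hψ ?_
  -- The constant is positive because `Γ(-1/2)` is negative.
  · set C := -b * (Real.Gamma (-(1 / 2)))⁻¹ with hC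
    have hCpos : 0 < C := mul_pos_of_neg_of_neg (by linarith) (inv_lt_zero.2 Gamma_neg_half_neg)
    refine ⟨C, hCpos, ?_⟩
    have key2 : Tendsto (fun n : ℕ => (a n : ℝ) * ρ ^ n * (n : ℝ) ^ (3 / 2 : ℝ)) atTop (𝓝 C) := by
      have := (Complex.continuous_re.tendsto _).comp key
      rw [hψ1] at this
      convert this using 2
      · simp [← Complex.ofReal_pow, ← Complex.ofReal_natCast, ← Complex.ofReal_mul]
      · simp [hC, ← Complex.ofReal_neg]
    have hne : ∀ᶠ n : ℕ in atTop, C * ρ⁻¹ ^ n * (n : ℝ) ^ (-(3 / 2) : ℝ) ≠ 0 := by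
      filter_upwards [eventually_gt_atTop 0] with n hn
      have : (0 : ℝ) < n := by exact_mod_cast hn
      positivity
    rw [isEquivalent_iff_tendsto_one hne]
    have key3 := key2.div_const C
    rw [div_self hCpos.ne'] at key3
    refine key3.congr' ?_
    filter_upwards [eventually_gt_atTop 0] with n hn
    have hn' : (0 : ℝ) < n := by exact_mod_cast hn
    rw [Pi.div_apply, Real.rpow_neg hn'.le, inv_pow]
    have := Real.rpow_pos_of_pos hn' (3 / 2)
    field_simp
  · simpa only [mul_pow, mul_assoc] using hf (ρ * z) (hmul z hz)
  · refine ⟨fun z => f (ρ * z), ?_, Eventually.of_forall fun _ => rfl⟩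
    refine AnalyticAt.comp (g := f) (f := fun z => (ρ : ℂ) * z) (hreg _ ?_ ?_) (by fun_prop)
    · rw [hnorm, hw, mul_one]
    · simpa [hρC] using hw1
  · have ht : Tendsto (fun z : ℂ => (ρ : ℂ) * z) (𝓝[Metric.ball 0 1] 1)
        (𝓝[Metric.ball 0 ρ] (ρ : ℂ)) := by
      refine tendsto_nhdsWithin_iff.2 ⟨?_, ?_⟩
      · exact (Continuous.tendsto' (by fun_prop) 1 (ρ : ℂ) (by simp)).mono_left nhdsWithin_le_nhds
      · filter_upwards [self_mem_nhdsWithin] with z hz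
        rw [mem_ball_zero_iff] at hz ⊢
        exact hmul z hz
    filter_upwards [ht.eventually h] with z hz
    rw [hz, singRoot_mul hρ]

end Singularity

end DeBruijnFormula

/-- `ι` is a finite, functionally complete set of connectives, with arities `ar` and truth
functions `tt`. The square root is the principal one, and `g` is the analytic continuation of the
generating function of all formulae to a slit disk that is larger than the disk of convergence. -/
theorem mainTheorem7 {ι : Type*} [Finite ι] (ar : ι → ℕ) (tt : ∀ i, (Fin (ar i) → Bool) → Bool)
    (hF : DeBruijnFormula.FunctionallyComplete tt) :
    ∃ ρ a b C : ℝ, 0 < ρ ∧ ρ < 1 ∧ 0 < a ∧ 0 < b ∧ 0 < C ∧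
      DeBruijnFormula.IsUniqueDominantSingularity (DeBruijnFormula.genCoeff ar) (ρ : ℂ) ∧
      (∃ R : ℝ, ρ < R ∧ ∃ g : ℂ → ℂ,
        AnalyticOnNhd ℂ g (DeBruijnFormula.slitDisk ρ R) ∧
        (∀ z : ℂ, ‖z‖ < ρ →
          HasSum (fun n : ℕ => DeBruijnFormula.genCoeff ar n * z ^ n) (g z)) ∧
        (∃ c : ℕ → ℂ, c 0 = (a : ℂ) ∧ c 1 = -(b : ℂ) ∧
          ∀ᶠ z in 𝓝[DeBruijnFormula.slitDisk ρ R] (ρ : ℂ),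
            HasSum (fun k : ℕ => c k * ((1 - z / (ρ : ℂ)) ^ (1 / 2 : ℂ)) ^ k) (g z)) ∧
        (fun z : ℂ => g z - ((a : ℂ) - (b : ℂ) * (1 - z / (ρ : ℂ)) ^ (1 / 2 : ℂ)))
          =O[𝓝[DeBruijnFormula.slitDisk ρ R] (ρ : ℂ)] fun z : ℂ => ‖1 - z / (ρ : ℂ)‖) ∧
      (fun n : ℕ => (DeBruijnFormula.count ar n : ℝ)) ~[atTop]
        fun n : ℕ => C * ρ⁻¹ ^ n * (n : ℝ) ^ (-(3 / 2) : ℝ) := by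
  open DeBruijnFormula in
  have := Fintype.ofFinite ι
  have har := exists_two_le_arity hF
  have hP := isBranching_branchPoly har
  obtain ⟨ρ, τ, hc⟩ := hP.exists_isCharacteristic
  obtain ⟨ψ, b, R, g, hb, hR, hψ, hψ0, hψ1, hg, hgf, hgψ⟩ := exists_slitDisk_continuation hP hc
  have hρ := hc.pos
  have hsum : ∀ z : ℂ, ‖z‖ < ρ →
      HasSum (fun n : ℕ => genCoeff ar n * z ^ n) (genFix (branchPoly ar) z) :=
    fun z hz => hasSum_genCoeff_genFix har hc hz
  have hreg : ∀ w : ℂ, ‖w‖ = ρ → w ≠ ρ → AnalyticAt ℂ (genFix (branchPoly ar)) w :=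
    fun w hw hw' => analyticOnNhd_genFix hP τ w (mem_contrDomain hP hc hw.le hw')
  have hsing : ∀ᶠ z in 𝓝[Metric.ball 0 ρ] (ρ : ℂ),
      genFix (branchPoly ar) z = ψ (singRoot ρ z) := by
    filter_upwards [nhdsWithin_le_nhds hgψ, self_mem_nhdsWithin] with z h1 h2
    rw [← h1, hgf z (by simpa using h2)]
  have hψ1' : deriv ψ 0 ≠ 0 := by
    rw [hψ1, neg_ne_zero]
    exact_mod_cast hb.ne'
  obtain ⟨C, hC, hasymp⟩ := isEquivalent_of_singRoot hρ hb hsum hreg hψ hψ1 hsing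
  obtain ⟨c, hc0, hc1, hcs⟩ := exists_coeff_eventually_hasSum hψ
  refine ⟨ρ, τ, b, C, hρ, hc.lt_one, hc.pos', hb, hC,
    isUniqueDominantSingularity_of_singRoot hρ hsum hreg hψ hψ1' hsing,
    ⟨R, hR, g, hg, fun z hz => hgf z hz ▸ hsum z hz,
      ⟨c, hc0.trans hψ0, hc1.trans hψ1, nhdsWithin_le_nhds ?_⟩, IsBigO.mono ?_ nhdsWithin_le_nhds⟩,
    hasymp⟩
  · filter_upwards [hgψ, (tendsto_singRoot hρ).eventually hcs] with z h1 h2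
    rw [h1]
    exact h2
  · refine ((isBigO_sub_linear hψ).comp_tendsto (tendsto_singRoot hρ)).congr' ?_ ?_
    · filter_upwards [hgψ] with z hz
      simp only [Function.comp_apply]
      rw [hz, hψ0, hψ1, singRoot]
      ring
    · exact Eventually.of_forall fun z => norm_singRoot_sq ρ z
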